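/- Let $\mathbb{D}$ be the open unit disc, $\mathbb{T}$ the unit circle and $\widehat{\mathbb{C}}=\mathbb{C}\cup\{\infty\}$. For $1\le p<\infty$ let $H^p(\mathbb{D})$ be the Banach space of analytic functions $f:\mathbb{D}\to\mathbb{C}$ with finite norm $$\|f\|_{H^p(\mathbb{D})}=\lim_{r\to1^-}\Big(\frac1{2\pi}\int_0^{2\pi}|f(re^{i\theta})|^p\,d\theta\Big)^{1/p}.$$ For a bounded linear operator $T$ on a complex normed space $X$: - $T$ has the single-valued extension property (SVEP) if for every open $U\subseteq\mathbb{C}$, every analytic $f:U\to X$ with $(T-zI)f(z)=0$ for all $z\in U$ vanishes identically on $U$. - For $x\in X$, the local resolvent $\rho_T(x)$ is the union of all open sets $U\subseteq\mathbb{C}$ on which there is an analytic $f:U\to X$ with $(T-zI)f(z)=x$ for all $z\in U$; the local spectrum is $\sigma_T(x)=\mathbb{C}\setminus\rho_T(x)$, and $X_T(F)=\{x\in X:\sigma_T(x)\subseteq F\}$ for $F\subseteq\mathbb{C}$. - $T$ has Dunford's property $(C)$ if $X_T(F)$ is closed for every closed $F\subseteq\mathbb{C}$. A hyperbolic automorphism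 of $\mathbb{D}$ is a bijection $\varphi:\mathbb{D}\to\mathbb{D}$ that is the restriction of a linear fractional transformation with exactly two fixed points in $\widehat{\mathbb{C}}$, both lying on $\mathbb{T}$. **Theorem.** Let $\varphi$ be a hyperbolic automorphism of $\mathbb{D}$. Then 1. for every $1\le p<\infty$, the composition operator $C_\varphi:f\mapsto f\circ\varphi$ is a (well-defined) bounded operator on $H^p(\mathbb{D})$ and does not have the SVEP; 2. for every $1<p<\infty$, the adjoint $C_\varphi^*:H^p(\mathbb{D})^*\to H^p(\mathbb{D})^*$, $\ell\mapsto\ell\circ C_\varphi$, has Dunford's property $(C)$. -/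

import Mathlib

open Filter Topology MeasureTheory
open scoped ENNReal Complex.UnitDisc

noncomputable section

namespace DunfordC

/-! ### Hardy spaces of the unit disc -/

/-- The normalized Lebesgue measure `dθ / 2π` on `(0, 2π]`. -/
def angleMeasure : Measure ℝ :=
  (ENNReal.ofReal (2 * Real.pi))⁻¹ • volume.restrict (Set.Ioc 0 (2 * Real.pi))

/-- The extension by zero to `ℂ` of a function on the open unit disc. -/
def zeroExt (f : 𝔻 → ℂ) : ℂ → ℂ := Function.extend Complex.UnitDisc.coe f 0

/-- A function on the open unit disc is analytic. -/
def IsAnalyticOnDisc (f : 𝔻 → ℂ) : Prop :=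
  DifferentiableOn ℂ (zeroExt f) (Metric.ball 0 1)

/-- The integral mean `(1/2π ∫₀^{2π} |f(r e^{iθ})|^p dθ)^{1/p}` for `0 < r < 1`. -/
def integralMean (p : ℝ≥0∞) (f : 𝔻 → ℂ) (r : ℝ) : ℝ≥0∞ :=
  eLpNorm (fun θ : ℝ => zeroExt f (circleMap 0 r θ)) p angleMeasure

/-- The Hardy norm, with values in `[0, ∞]`: the limit of the integral means as `r → 1⁻`.
For analytic `f` the means are nondecreasing in `r`, so the upper limit is the limit. -/
def hardyENorm (p : ℝ≥0∞) (f : 𝔻 → ℂ) : ℝ≥0∞ :=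
  limsup (integralMean p f) (𝓝[<] (1 : ℝ))

instance isProbabilityMeasure_angleMeasure : IsProbabilityMeasure angleMeasure := by
  constructor
  have h : ENNReal.ofReal (2 * Real.pi) ≠ 0 := by
    simp [Real.pi_pos]
  simp only [angleMeasure, Measure.smul_apply, Measure.restrict_apply MeasurableSet.univ,
    Set.univ_inter, Real.volume_Ioc, sub_zero, smul_eq_mul]
  exact ENNReal.inv_mul_cancel h ENNReal.ofReal_ne_top

@[simp] lemma zeroExt_coe (f : 𝔻 → ℂ) (z : 𝔻) : zeroExt f z = f z :=
  Complex.UnitDisc.coe_injective.extend_apply f 0 z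

lemma zeroExt_add (f g : 𝔻 → ℂ) : zeroExt (f + g) = zeroExt f + zeroExt g := by
  simpa [zeroExt] using Function.extend_add Complex.UnitDisc.coe f g 0 0

lemma zeroExt_smul (c : ℂ) (f : 𝔻 → ℂ) : zeroExt (c • f) = c • zeroExt f := by
  simpa [zeroExt] using Function.extend_smul c Complex.UnitDisc.coe f 0

lemma zeroExt_zero : zeroExt 0 = 0 := by
  simpa using zeroExt_smul 0 0

lemma eventually_radius : ∀ᶠ r : ℝ in 𝓝[<] (1 : ℝ), 0 < r ∧ r < 1 := by
  filter_upwards [Ioo_mem_nhdsLT (show (0 : ℝ) < 1 by norm_num)] with r hr using hr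

lemma continuous_circle {f : 𝔻 → ℂ} (hf : IsAnalyticOnDisc f) {r : ℝ} (h0 : 0 < r)
    (h1 : r < 1) : Continuous (fun θ : ℝ => zeroExt f (circleMap 0 r θ)) := by
  refine hf.continuousOn.comp_continuous (continuous_circleMap 0 r) fun θ => ?_
  simp [abs_of_pos h0, h1]

lemma hardyENorm_add_le {p : ℝ≥0∞} (hp : 1 ≤ p) {f g : 𝔻 → ℂ} (hf : IsAnalyticOnDisc f)
    (hg : IsAnalyticOnDisc g) : hardyENorm p (f + g) ≤ hardyENorm p f + hardyENorm p g := by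
  refine ENNReal.le_of_forall_pos_le_add fun ε hε hfin => ?_
  have hε2 : (ε / 2 : ℝ≥0∞) ≠ 0 := by simpa using hε.ne'
  obtain ⟨hF, hG⟩ := ENNReal.add_lt_top.1 hfin
  refine limsup_le_of_le (by isBoundedDefault) ?_
  filter_upwards [eventually_radius,
    eventually_lt_of_limsup_lt (f := 𝓝[<] (1 : ℝ)) (ENNReal.lt_add_right hF.ne hε2),
    eventually_lt_of_limsup_lt (f := 𝓝[<] (1 : ℝ)) (ENNReal.lt_add_right hG.ne hε2)]
    with r hr h1 h2
  have h : integralMean p (f + g) r ≤ integralMean p f r + integralMean p g r := by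
    simp only [integralMean, zeroExt_add]
    exact eLpNorm_add_le (continuous_circle hf hr.1 hr.2).aestronglyMeasurable
      (continuous_circle hg hr.1 hr.2).aestronglyMeasurable hp
  refine (h.trans (add_le_add h1.le h2.le)).trans_eq ?_
  rw [add_add_add_comm, ENNReal.add_halves]
  rfl

lemma hardyENorm_smul (p : ℝ≥0∞) (c : ℂ) (f : 𝔻 → ℂ) :
    hardyENorm p (c • f) = ‖c‖ₑ * hardyENorm p f := by
  have h : integralMean p (c • f) = fun r => ‖c‖ₑ * integralMean p f r := by
    funext r
    simp only [integralMean, zeroExt_smul]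
    exact eLpNorm_const_smul c _ p _
  rw [hardyENorm, h, ENNReal.limsup_const_mul_of_ne_top enorm_ne_top, hardyENorm]

/-- Point evaluations are controlled by the Hardy norm. -/
lemma exists_enorm_apply_le {p : ℝ≥0∞} (hp : 1 ≤ p) {f : 𝔻 → ℂ} (hf : IsAnalyticOnDisc f)
    (w : 𝔻) : ∃ C : ℝ≥0∞, C ≠ ∞ ∧ ‖f w‖ₑ ≤ C * hardyENorm p f := by
  have hw : ‖(w : ℂ)‖ < 1 := w.norm_lt_one
  set s : ℝ := (1 + ‖(w : ℂ)‖) / 2 with hs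
  have hws : ‖(w : ℂ)‖ < s := by rw [hs]; linarith
  have hs1 : s < 1 := by rw [hs]; linarith
  have hspos : 0 < s := lt_of_le_of_lt (norm_nonneg _) hws
  set K : ℝ := 1 / (s - ‖(w : ℂ)‖) with hK
  refine ⟨ENNReal.ofReal K, ENNReal.ofReal_ne_top, ?_⟩
  rw [hardyENorm, ← ENNReal.limsup_const_mul_of_ne_top ENNReal.ofReal_ne_top]
  refine le_limsup_of_frequently_le (Eventually.frequently ?_)
  filter_upwards [Ioo_mem_nhdsLT hs1] with r hr
  have hr0 : 0 < r := hspos.trans hr.1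
  have hball : Metric.closedBall (0 : ℂ) |r| ⊆ Metric.ball 0 1 := by
    rw [abs_of_pos hr0]
    exact Metric.closedBall_subset_ball hr.2
  have hmv := DiffContOnCl.circleAverage_smul_div (f := zeroExt f) (c := 0) (R := r) (w := w)
    ((hf.mono (Metric.closure_ball_subset_closedBall.trans hball)).diffContOnCl)
    (by rw [abs_of_pos hr0]; simpa using hws.trans hr.1)
  have hcont := continuous_circle hf hr0 hr.2
  rw [zeroExt_coe] at hmv
  have hint : f w = ∫ θ, ((circleMap 0 r θ - 0) / (circleMap 0 r θ - w)) •
      zeroExt f (circleMap 0 r θ) ∂angleMeasure := by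
    rw [← hmv, Real.circleAverage_def, angleMeasure, integral_smul_measure,
      intervalIntegral.integral_of_le (by positivity)]
    congr 1
    rw [ENNReal.toReal_inv, ENNReal.toReal_ofReal (by positivity)]
  rw [hint]
  refine (enorm_integral_le_lintegral_enorm _).trans ?_
  have hle : ∫⁻ θ, ‖((circleMap 0 r θ - 0) / (circleMap 0 r θ - w)) •
      zeroExt f (circleMap 0 r θ)‖ₑ ∂angleMeasure ≤
      ∫⁻ θ, ENNReal.ofReal K * ‖zeroExt f (circleMap 0 r θ)‖ₑ ∂angleMeasure := by
    refine lintegral_mono fun θ => ?_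
    rw [enorm_smul]
    gcongr
    rw [← ofReal_norm]
    refine ENNReal.ofReal_le_ofReal ?_
    have hn : ‖circleMap 0 r θ‖ = r := by simp [abs_of_pos hr0]
    have hd : s - ‖(w : ℂ)‖ ≤ ‖circleMap 0 r θ - w‖ := by
      have := norm_sub_norm_le (circleMap 0 r θ) w
      rw [hn] at this
      linarith [hr.1]
    rw [sub_zero, norm_div, hn, hK]
    exact div_le_div₀ zero_le_one hr.2.le (by linarith) hd
  refine hle.trans ?_
  rw [lintegral_const_mul' _ _ ENNReal.ofReal_ne_top]
  gcongr
  rw [← eLpNorm_one_eq_lintegral_enorm]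
  exact eLpNorm_le_eLpNorm_of_exponent_le hp hcont.aestronglyMeasurable

/-- The analytic functions on the disc with finite Hardy norm, as a linear subspace of the space
of all functions on the disc. -/
def hardySubmodule (p : ℝ≥0∞) [hp : Fact (1 ≤ p)] : Submodule ℂ (𝔻 → ℂ) where
  carrier := {f | IsAnalyticOnDisc f ∧ hardyENorm p f < ∞}
  zero_mem' := by
    refine ⟨?_, ?_⟩
    · rw [IsAnalyticOnDisc, zeroExt_zero]
      exact differentiableOn_const 0
    · have h := hardyENorm_smul p 0 0
      simp only [zero_smul, enorm_zero, zero_mul] at h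
      rw [h]
      exact ENNReal.zero_lt_top
  add_mem' := by
    rintro f g ⟨hf, hf'⟩ ⟨hg, hg'⟩
    refine ⟨?_, (hardyENorm_add_le hp.out hf hg).trans_lt (ENNReal.add_lt_top.2 ⟨hf', hg'⟩)⟩
    rw [IsAnalyticOnDisc, zeroExt_add]
    exact hf.add hg
  smul_mem' := by
    rintro c f ⟨hf, hf'⟩
    refine ⟨?_, ?_⟩
    · rw [IsAnalyticOnDisc, zeroExt_smul]
      exact hf.const_smul c
    · rw [hardyENorm_smul]
      exact ENNReal.mul_lt_top enorm_lt_top hf'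

/-- The Hardy space `H^p(𝔻)`. It is a type of its own, so that it carries the topology of the
Hardy norm and not that of pointwise convergence. -/
def HardySpace (p : ℝ≥0∞) [Fact (1 ≤ p)] : Type := hardySubmodule p

instance (p : ℝ≥0∞) [Fact (1 ≤ p)] : AddCommGroup (HardySpace p) :=
  inferInstanceAs (AddCommGroup (hardySubmodule p))

instance (p : ℝ≥0∞) [Fact (1 ≤ p)] : Module ℂ (HardySpace p) :=
  inferInstanceAs (Module ℂ (hardySubmodule p))

instance (p : ℝ≥0∞) [Fact (1 ≤ p)] : CoeFun (HardySpace p) (fun _ => 𝔻 → ℂ) :=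
  ⟨fun f => f.1⟩

instance (p : ℝ≥0∞) [Fact (1 ≤ p)] : Norm (HardySpace p) :=
  ⟨fun f => (hardyENorm p f).toReal⟩

lemma hardySpace_core (p : ℝ≥0∞) [hp : Fact (1 ≤ p)] : NormedSpace.Core ℂ (HardySpace p) where
  norm_nonneg f := ENNReal.toReal_nonneg
  norm_smul c f := by
    change (hardyENorm p (c • f.1)).toReal = _
    rw [hardyENorm_smul, ENNReal.toReal_mul, toReal_enorm]
    rfl
  norm_triangle f g := by
    change (hardyENorm p (f.1 + g.1)).toReal ≤ (hardyENorm p f.1).toReal + (hardyENorm p g.1).toReal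
    rw [← ENNReal.toReal_add f.2.2.ne g.2.2.ne]
    exact ENNReal.toReal_mono (ENNReal.add_lt_top.2 ⟨f.2.2, g.2.2⟩).ne
      (hardyENorm_add_le hp.out f.2.1 g.2.1)
  norm_eq_zero_iff f := by
    constructor
    · intro h
      have h0 : hardyENorm p f.1 = 0 :=
        ((ENNReal.toReal_eq_zero_iff _).1 h).resolve_right f.2.2.ne
      refine Subtype.ext (funext fun w => ?_)
      obtain ⟨C, -, hC⟩ := exists_enorm_apply_le hp.out f.2.1 w
      rw [h0, mul_zero] at hC
      exact enorm_eq_zero.1 (le_zero_iff.1 hC)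
    · rintro rfl
      have h := hardyENorm_smul p 0 0
      simp only [zero_smul, enorm_zero, zero_mul] at h
      change (hardyENorm p 0).toReal = 0
      rw [h, ENNReal.toReal_zero]

instance (p : ℝ≥0∞) [Fact (1 ≤ p)] : NormedAddCommGroup (HardySpace p) :=
  NormedAddCommGroup.ofCore (hardySpace_core p)

instance (p : ℝ≥0∞) [Fact (1 ≤ p)] : NormedSpace ℂ (HardySpace p) :=
  NormedSpace.ofCore (hardySpace_core p)

/-! ### Composition operators and adjoints -/

/-- The bounded operator `C` on `H^p(𝔻)` is the composition operator `f ↦ f ∘ φ`. -/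
def IsCompositionOperator {p : ℝ≥0∞} [Fact (1 ≤ p)] (φ : 𝔻 → 𝔻)
    (C : HardySpace p →L[ℂ] HardySpace p) : Prop :=
  ∀ (f : HardySpace p) (z : 𝔻), C f z = f (φ z)

/-- The Banach space adjoint `T* : X* → X*`, `ℓ ↦ ℓ ∘ T`. -/
def adjointOp {X : Type*} [NormedAddCommGroup X] [NormedSpace ℂ X] (T : X →L[ℂ] X) :
    StrongDual ℂ X →L[ℂ] StrongDual ℂ X :=
  ContinuousLinearMap.precomp ℂ T

/-- `φ` is a hyperbolic automorphism of the disc: a bijective self-map of the disc induced by a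
linear fractional transformation `g` whose fixed points in the Riemann sphere `ℂ ∪ {∞}` are
exactly two, both of them on the unit circle. -/
def IsHyperbolicAutomorphism (φ : 𝔻 → 𝔻) : Prop :=
  Function.Bijective φ ∧ ∃ g : GL (Fin 2) ℂ,
    (∀ z : 𝔻, g • ((z : ℂ) : OnePoint ℂ) = ((φ z : ℂ) : OnePoint ℂ)) ∧
    ∃ α β : ℂ, α ≠ β ∧ ‖α‖ = 1 ∧ ‖β‖ = 1 ∧
      {w : OnePoint ℂ | g • w = w} = {(α : OnePoint ℂ), (β : OnePoint ℂ)}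

/-! ### Local spectral theory -/

/-- The single-valued extension property. -/
def HasSVEP {X : Type*} [NormedAddCommGroup X] [NormedSpace ℂ X] (T : X →L[ℂ] X) : Prop :=
  ∀ (U : Set ℂ) (f : ℂ → X), IsOpen U → AnalyticOnNhd ℂ f U →
    (∀ z ∈ U, T (f z) - z • f z = 0) → ∀ z ∈ U, f z = 0

/-- The local resolvent `ρ_T(x)`: the union of all open sets `U` on which there is an analytic
`f : U → X` with `(T - z I) f(z) = x`. -/
def localResolvent {X : Type*} [NormedAddCommGroup X] [NormedSpace ℂ X] (T : X →L[ℂ] X)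
    (x : X) : Set ℂ :=
  ⋃₀ {U : Set ℂ | IsOpen U ∧ ∃ f : ℂ → X, AnalyticOnNhd ℂ f U ∧
    ∀ z ∈ U, T (f z) - z • f z = x}

/-- The local spectrum `σ_T(x) = ℂ \ ρ_T(x)`. -/
def localSpectrum {X : Type*} [NormedAddCommGroup X] [NormedSpace ℂ X] (T : X →L[ℂ] X)
    (x : X) : Set ℂ :=
  (localResolvent T x)ᶜ

/-- The local spectral subspace `X_T(F) = {x : σ_T(x) ⊆ F}`. -/
def localSpectralSubspace {X : Type*} [NormedAddCommGroup X] [NormedSpace ℂ X] (T : X →L[ℂ] X)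
    (F : Set ℂ) : Set X :=
  {x | localSpectrum T x ⊆ F}

/-- Dunford's property (C). -/
def HasDunfordC {X : Type*} [NormedAddCommGroup X] [NormedSpace ℂ X] (T : X →L[ℂ] X) : Prop :=
  ∀ F : Set ℂ, IsClosed F → IsClosed (localSpectralSubspace T F)

end DunfordC

end

/-!
The half-plane coordinate `σ z = c (α - z) / (z - β)` of the fixed points `α`, `β` conjugates a
hyperbolic automorphism `φ` to a dilation `x ↦ e^t x`, `t ≠ 0`, of the right half-plane
(`IsHyperbolicAutomorphism.exists_eq_flow`). Thus `φ` is a member of a one-parameter group, the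
`Axis.flow`, and the powers `σ ^ s` are eigenfunctions of all its composition operators, with
eigenvalues `e^{s t}`. They belong to `H^p` for `|Re s| < 1 / p`, because `σ ^ (s p)` then has
values in a sector, where the modulus is controlled by the real part
(`Axis.exists_hardyENorm_le`), and they depend holomorphically on `s`
(`Axis.differentiableAt_powHardy`). So the eigenvectors form a holomorphic family over an open set
of eigenvalues, and the SVEP fails.

For the adjoint, let `ℓ` be a functional whose local resolvent meets the open annulus
`e^{-|t| / p} < |z| < e^{|t| / p}`. Pairing the local resolvent equation with the eigenvectors gives
`ℓ (σ ^ s) = 0` for `s` in an open set, hence on the whole strip. For `1 < p < ∞` the powers `σ ^ s`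
are complete in `H^p` (`Axis.eq_zero_of_apply_powHardy`), so that `ℓ = 0`. On the other hand the
Littlewood subordination bound (`integralMean_comp_le`, from the Poisson integral) shows
`‖C_{flow t}‖ ≤ M e^{|t| / p}`, which places the spectrum in the closed annulus. Consequently a
local spectral subspace of a closed set `F` is the whole space if `F` contains the closed annulus,
and trivial otherwise; both are closed.

The completeness of the powers is obtained by Fourier analysis along the flow. If `f` is Lipschitz
and vanishes at `β`, then `e^{ε r} ℓ (f ∘ flow r)` is an integrable function of `r`, and its Fourier
transform is the value of `ℓ` at an eigenvector of the flow in `H^p`, that is, at a multiple of some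
`σ ^ s`. By Fourier inversion `ℓ f = 0`. This applies to the dilations of an arbitrary `f ∈ H^p`, up
to constants, and they converge to `f` by a uniform convexity argument
(`exists_hardyENorm_sub_dilate_le`), which is where `1 < p` enters.
-/

noncomputable section

namespace DunfordC

/-! ### Poisson kernels and subordination -/

lemma circleAverage_eq_integral_angleMeasure {E : Type*} [NormedAddCommGroup E] [NormedSpace ℝ E]
    (f : ℂ → E) (r : ℝ) :
    Real.circleAverage f 0 r = ∫ θ, f (circleMap 0 r θ) ∂angleMeasure := by
  rw [Real.circleAverage_def, angleMeasure, integral_smul_measure,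
    intervalIntegral.integral_of_le (by positivity)]
  congr 1
  rw [ENNReal.toReal_inv, ENNReal.toReal_ofReal (by positivity)]

lemma integrable_angleMeasure {E : Type*} [NormedAddCommGroup E] {f : ℝ → E} (hf : Continuous f) :
    Integrable f angleMeasure := by
  refine Integrable.smul_measure ?_ (by simp [Real.pi_pos])
  exact (hf.integrableOn_Icc (a := 0) (b := 2 * Real.pi)).mono_set Set.Ioc_subset_Icc_self

lemma circleMap_sub_ne_zero {w : ℂ} (hw : ‖w‖ < 1) (θ : ℝ) : circleMap 0 1 θ - w ≠ 0 := by
  intro h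
  rw [sub_eq_zero] at h
  rw [← h] at hw
  simp at hw

lemma poissonKernel_nonneg {w : ℂ} (hw : ‖w‖ < 1) (θ : ℝ) :
    0 ≤ poissonKernel 0 w (circleMap 0 1 θ) := by
  have : ‖w‖ ^ 2 ≤ 1 := by nlinarith [norm_nonneg w]
  rw [poissonKernel_def]
  apply div_nonneg _ (by positivity)
  simpa using this

lemma poissonKernel_le {w : ℂ} (hw : ‖w‖ < 1) (θ : ℝ) :
    poissonKernel 0 w (circleMap 0 1 θ) ≤ (1 + ‖w‖) / (1 - ‖w‖) := by
  rw [poissonKernel_eq_re_herglotzRieszKernel, Function.comp_apply, herglotzRieszKernel_def]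
  simpa using re_herglotzRieszKernel_le (c := 0) (z := circleMap 0 1 θ) (w := w) (R := 1)
    (by simp) (by simpa using hw)

lemma continuous_poissonKernel {X : Type*} [TopologicalSpace X] {w : X → ℂ} {θ : X → ℝ}
    (hw : Continuous w) (hθ : Continuous θ) (h : ∀ x, ‖w x‖ < 1) :
    Continuous fun x => poissonKernel 0 (w x) (circleMap 0 1 (θ x)) := by
  simp only [poissonKernel_def, sub_zero]
  have hc : Continuous fun x => circleMap 0 1 (θ x) := (continuous_circleMap 0 1).comp hθ
  refine Continuous.div (by fun_prop) (by fun_prop) fun x => ?_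
  simpa using circleMap_sub_ne_zero (h x) (θ x)

lemma integral_poissonKernel {w : ℂ} (hw : ‖w‖ < 1) {F : ℂ → ℂ}
    (hF : DiffContOnCl ℂ F (Metric.ball 0 1)) :
    ∫ θ, poissonKernel 0 w (circleMap 0 1 θ) • F (circleMap 0 1 θ) ∂angleMeasure = F w := by
  have h := hF.circleAverage_poissonKernel_smul (w := w) (by simpa using hw)
  rwa [circleAverage_eq_integral_angleMeasure] at h

lemma lintegral_poissonKernel {w : ℂ} (hw : ‖w‖ < 1) :
    ∫⁻ θ, ENNReal.ofReal (poissonKernel 0 w (circleMap 0 1 θ)) ∂angleMeasure = 1 := by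
  have h := integral_poissonKernel hw (F := fun _ => 1) diffContOnCl_const
  have h' : ((∫ θ, poissonKernel 0 w (circleMap 0 1 θ) ∂angleMeasure : ℝ) : ℂ) = 1 := by
    rw [← integral_complex_ofReal, ← h]
    simp
  rw [← ofReal_integral_eq_lintegral_ofReal (integrable_angleMeasure
    (continuous_poissonKernel continuous_const continuous_id' fun _ => hw))
    (ae_of_all _ (poissonKernel_nonneg hw))]
  have h1 : (∫ θ, poissonKernel 0 w (circleMap 0 1 θ) ∂angleMeasure : ℝ) = 1 := by
    exact_mod_cast h'
  rw [h1, ENNReal.ofReal_one]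

lemma continuous_comp_circleMap_one {F : ℂ → ℂ} (hF : DiffContOnCl ℂ F (Metric.ball 0 1)) :
    Continuous fun θ : ℝ => F (circleMap 0 1 θ) := by
  refine hF.continuousOn.comp_continuous (continuous_circleMap 0 1) fun θ => ?_
  rw [closure_ball _ one_ne_zero]
  simp

/-- Jensen's inequality for the Poisson integral: `|F|^p` lies below the Poisson integral of its
boundary values. -/
lemma enorm_rpow_le_lintegral_poissonKernel {p : ℝ≥0∞} (hp : 1 ≤ p) (hp' : p ≠ ∞) {w : ℂ}
    (hw : ‖w‖ < 1) {F : ℂ → ℂ} (hF : DiffContOnCl ℂ F (Metric.ball 0 1)) :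
    ‖F w‖ₑ ^ p.toReal ≤ ∫⁻ θ, ENNReal.ofReal (poissonKernel 0 w (circleMap 0 1 θ)) *
      ‖F (circleMap 0 1 θ)‖ₑ ^ p.toReal ∂angleMeasure := by
  have hq : 0 < p.toReal := ENNReal.toReal_pos (by positivity) hp'
  have hPc : Continuous fun θ => ENNReal.ofReal (poissonKernel 0 w (circleMap 0 1 θ)) :=
    ENNReal.continuous_ofReal.comp
      (continuous_poissonKernel continuous_const continuous_id' fun _ => hw)
  have hFc := continuous_comp_circleMap_one hF
  set ν := angleMeasure.withDensity
    fun θ => ENNReal.ofReal (poissonKernel 0 w (circleMap 0 1 θ)) with hν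
  have : IsProbabilityMeasure ν := ⟨by
    rw [hν, withDensity_apply _ MeasurableSet.univ, Measure.restrict_univ,
      lintegral_poissonKernel hw]⟩
  have hconv (g : ℝ → ℝ≥0∞) (hg : Measurable g) : ∫⁻ θ, g θ ∂ν =
      ∫⁻ θ, ENNReal.ofReal (poissonKernel 0 w (circleMap 0 1 θ)) * g θ ∂angleMeasure :=
    lintegral_withDensity_eq_lintegral_mul _ hPc.measurable hg
  have h1 : ‖F w‖ₑ ≤ eLpNorm (fun θ => F (circleMap 0 1 θ)) 1 ν := by
    rw [eLpNorm_one_eq_lintegral_enorm, hconv _ hFc.enorm.measurable,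
      ← integral_poissonKernel hw hF]
    refine (enorm_integral_le_lintegral_enorm _).trans_eq (lintegral_congr fun θ => ?_)
    rw [enorm_smul, Real.enorm_of_nonneg (poissonKernel_nonneg hw θ)]
  have h2 := h1.trans (eLpNorm_le_eLpNorm_of_exponent_le hp hFc.aestronglyMeasurable)
  rw [eLpNorm_eq_lintegral_rpow_enorm_toReal (by positivity) hp',
    hconv _ (hFc.enorm.measurable.pow_const _)] at h2
  calc _ ≤ _ := ENNReal.rpow_le_rpow h2 hq.le
    _ = _ := by rw [← ENNReal.rpow_mul, one_div_mul_cancel hq.ne', ENNReal.rpow_one]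

/-- The Poisson kernel is harmonic in its first variable, so its mean along the image of a circle
under an analytic self-map `Ψ` of the disc is its value at `Ψ 0`. -/
lemma lintegral_poissonKernel_comp {Ψ : ℂ → ℂ} (hΨ : DifferentiableOn ℂ Ψ (Metric.ball 0 1))
    (hmap : ∀ z, ‖z‖ < 1 → ‖Ψ z‖ < 1) {r : ℝ} (hr : 0 ≤ r) (hr1 : r < 1) (t : ℝ) :
    ∫⁻ θ, ENNReal.ofReal (poissonKernel 0 (Ψ (circleMap 0 r θ)) (circleMap 0 1 t)) ∂angleMeasure =
      ENNReal.ofReal (poissonKernel 0 (Ψ 0) (circleMap 0 1 t)) := by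
  set ζ := circleMap 0 1 t
  have hsub : Metric.closedBall (0 : ℂ) r ⊆ Metric.ball 0 1 := Metric.closedBall_subset_ball hr1
  have hcirc (θ : ℝ) : ‖circleMap 0 r θ‖ < 1 := by simpa [abs_of_nonneg hr] using hr1
  have hΨc : Continuous fun θ => Ψ (circleMap 0 r θ) :=
    hΨ.continuousOn.comp_continuous (continuous_circleMap 0 r) fun θ => by
      simpa using hcirc θ
  have hd : DifferentiableOn ℂ (fun z => (ζ + Ψ z) / (ζ - Ψ z)) (Metric.ball 0 1) := by
    refine DifferentiableOn.div (hΨ.const_add _) (hΨ.const_sub _) fun z hz => ?_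
    exact circleMap_sub_ne_zero (hmap z (by simpa using hz)) t
  have hav := DiffContOnCl.circleAverage (f := fun z => (ζ + Ψ z) / (ζ - Ψ z)) (c := 0) (R := r)
    ((hd.mono (Metric.closure_ball_subset_closedBall.trans
      (by rw [abs_of_nonneg hr]; exact hsub))).diffContOnCl)
  have hker (z : ℂ) : poissonKernel 0 (Ψ z) ζ = ((ζ + Ψ z) / (ζ - Ψ z)).re := by
    rw [poissonKernel_eq_re_herglotzRieszKernel, Function.comp_apply, herglotzRieszKernel_def]
    simp
  rw [circleAverage_eq_integral_angleMeasure] at hav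
  rw [← ofReal_integral_eq_lintegral_ofReal (integrable_angleMeasure
    (continuous_poissonKernel hΨc continuous_const fun θ => hmap _ (hcirc θ)))
    (ae_of_all _ fun θ => poissonKernel_nonneg (hmap _ (hcirc θ)) t), hker 0, ← hav]
  congr 1
  refine (integral_congr_ae (ae_of_all _ fun θ => hker _)).trans ?_
  refine Complex.reCLM.integral_comp_comm (integrable_angleMeasure
    (f := fun θ => (ζ + Ψ (circleMap 0 r θ)) / (ζ - Ψ (circleMap 0 r θ))) ?_)
  exact hd.continuousOn.comp_continuous (continuous_circleMap 0 r) fun θ => by simpa using hcirc θ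

/-- **Littlewood subordination** with the explicit constant coming from Harnack's inequality. -/
lemma eLpNorm_comp_circleMap_le {p : ℝ≥0∞} (hp : 1 ≤ p) (hp' : p ≠ ∞) {F : ℂ → ℂ}
    (hF : DiffContOnCl ℂ F (Metric.ball 0 1)) {Ψ : ℂ → ℂ}
    (hΨ : DifferentiableOn ℂ Ψ (Metric.ball 0 1)) (hmap : ∀ z, ‖z‖ < 1 → ‖Ψ z‖ < 1)
    {r : ℝ} (hr : 0 ≤ r) (hr1 : r < 1) :
    eLpNorm (fun θ => F (Ψ (circleMap 0 r θ))) p angleMeasure ≤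
      ENNReal.ofReal ((1 + ‖Ψ 0‖) / (1 - ‖Ψ 0‖)) ^ (1 / p.toReal) *
        eLpNorm (fun θ => F (circleMap 0 1 θ)) p angleMeasure := by
  have hq : 0 < p.toReal := ENNReal.toReal_pos (by positivity) hp'
  have hcirc (θ : ℝ) : ‖circleMap 0 r θ‖ < 1 := by simpa [abs_of_nonneg hr] using hr1
  have hΨc : Continuous fun θ => Ψ (circleMap 0 r θ) :=
    hΨ.continuousOn.comp_continuous (continuous_circleMap 0 r) fun θ => by
      simpa using hcirc θ
  have hFc := continuous_comp_circleMap_one hF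
  simp only [eLpNorm_eq_lintegral_rpow_enorm_toReal (show p ≠ 0 by positivity) hp']
  rw [← ENNReal.mul_rpow_of_nonneg _ _ (by positivity)]
  refine ENNReal.rpow_le_rpow ?_ (by positivity)
  have hjoint : Measurable fun x : ℝ × ℝ =>
      ENNReal.ofReal (poissonKernel 0 (Ψ (circleMap 0 r x.1)) (circleMap 0 1 x.2)) *
        ‖F (circleMap 0 1 x.2)‖ₑ ^ p.toReal := by
    refine Measurable.mul ?_ ((hFc.enorm.measurable.comp measurable_snd).pow_const _)
    exact (ENNReal.continuous_ofReal.comp (continuous_poissonKernel (hΨc.comp continuous_fst)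
      continuous_snd fun x => hmap _ (hcirc x.1))).measurable
  calc _ ≤ ∫⁻ θ, ∫⁻ t, ENNReal.ofReal
          (poissonKernel 0 (Ψ (circleMap 0 r θ)) (circleMap 0 1 t)) *
            ‖F (circleMap 0 1 t)‖ₑ ^ p.toReal ∂angleMeasure ∂angleMeasure :=
        lintegral_mono fun θ =>
          enorm_rpow_le_lintegral_poissonKernel hp hp' (hmap _ (hcirc θ)) hF
    _ = ∫⁻ t, ∫⁻ θ, ENNReal.ofReal
          (poissonKernel 0 (Ψ (circleMap 0 r θ)) (circleMap 0 1 t)) *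
            ‖F (circleMap 0 1 t)‖ₑ ^ p.toReal ∂angleMeasure ∂angleMeasure :=
        lintegral_lintegral_swap hjoint.aemeasurable
    _ ≤ ∫⁻ t, ENNReal.ofReal ((1 + ‖Ψ 0‖) / (1 - ‖Ψ 0‖)) *
            ‖F (circleMap 0 1 t)‖ₑ ^ p.toReal ∂angleMeasure := by
        refine lintegral_mono fun t => ?_
        rw [lintegral_mul_const' _ _
          (ENNReal.rpow_ne_top_of_nonneg hq.le enorm_ne_top),
          lintegral_poissonKernel_comp hΨ hmap hr hr1]
        gcongr
        exact poissonKernel_le (hmap 0 (by simp)) t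
    _ = _ := lintegral_const_mul' _ _ ENNReal.ofReal_ne_top

/-! ### Integral means and the Hardy norm -/

lemma zeroExt_apply (f : 𝔻 → ℂ) {z : ℂ} (hz : ‖z‖ < 1) :
    zeroExt f z = f (Complex.UnitDisc.mk z hz) :=
  zeroExt_coe f (Complex.UnitDisc.mk z hz)

lemma isAnalyticOnDisc_coe {F : ℂ → ℂ} (hF : DifferentiableOn ℂ F (Metric.ball 0 1)) :
    IsAnalyticOnDisc fun z : 𝔻 => F z :=
  hF.congr fun z hz => by rw [zeroExt_apply _ (by simpa using hz), Complex.UnitDisc.coe_mk]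

lemma isAnalyticOnDisc_coeFun : IsAnalyticOnDisc fun z : 𝔻 => (z : ℂ) :=
  isAnalyticOnDisc_coe (F := fun z => z) differentiableOn_id

lemma IsAnalyticOnDisc.comp {f : 𝔻 → ℂ} (hf : IsAnalyticOnDisc f) {ψ : 𝔻 → 𝔻}
    (hψ : IsAnalyticOnDisc fun z => (ψ z : ℂ)) : IsAnalyticOnDisc fun z => f (ψ z) := by
  have h := DifferentiableOn.comp hf hψ (t := Metric.ball 0 1) fun z hz => by
    rw [zeroExt_apply _ (by simpa using hz)]
    simpa using (ψ _).norm_lt_one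
  refine h.congr fun z hz => ?_
  have hz' : ‖z‖ < 1 := by simpa using hz
  rw [Function.comp_apply, zeroExt_apply _ hz', zeroExt_apply _ hz', zeroExt_coe]

lemma norm_circleMap_lt_one {r : ℝ} (h0 : 0 ≤ r) (h1 : r < 1) (θ : ℝ) :
    ‖circleMap 0 r θ‖ < 1 := by
  simpa [abs_of_nonneg h0] using h1

lemma integralMean_le_mul {p : ℝ≥0∞} {f g : 𝔻 → ℂ} {M : ℝ} (h : ∀ z, ‖g z‖ ≤ M * ‖f z‖) {r : ℝ}
    (h0 : 0 < r) (h1 : r < 1) :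
    integralMean p g r ≤ ENNReal.ofReal M * integralMean p f r := by
  refine eLpNorm_le_mul_eLpNorm_of_ae_le_mul (ae_of_all _ fun θ => ?_) p
  rw [zeroExt_apply _ (norm_circleMap_lt_one h0.le h1 θ),
    zeroExt_apply _ (norm_circleMap_lt_one h0.le h1 θ)]
  exact h _

lemma hardyENorm_le_of_integralMean_le {p : ℝ≥0∞} {f : 𝔻 → ℂ} {K : ℝ≥0∞}
    (h : ∀ r : ℝ, 0 < r → r < 1 → integralMean p f r ≤ K) : hardyENorm p f ≤ K := by
  refine limsup_le_of_le (by isBoundedDefault) ?_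
  filter_upwards [eventually_radius] with r hr using h r hr.1 hr.2

lemma hardyENorm_le_mul {p : ℝ≥0∞} {f g : 𝔻 → ℂ} {M : ℝ} (h : ∀ z, ‖g z‖ ≤ M * ‖f z‖) :
    hardyENorm p g ≤ ENNReal.ofReal M * hardyENorm p f := by
  rw [hardyENorm, hardyENorm, ← ENNReal.limsup_const_mul_of_ne_top ENNReal.ofReal_ne_top]
  refine limsup_le_limsup ?_ (by isBoundedDefault) (by isBoundedDefault)
  filter_upwards [eventually_radius] with r hr using integralMean_le_mul h hr.1 hr.2

lemma integralMean_const {p : ℝ≥0∞} (hp : 1 ≤ p) (c : ℂ) {r : ℝ} (h0 : 0 < r) (h1 : r < 1) :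
    integralMean p (fun _ => c) r = ‖c‖ₑ := by
  have : (fun θ : ℝ => zeroExt (fun _ => c) (circleMap 0 r θ)) = fun _ => c := by
    funext θ
    rw [zeroExt_apply _ (norm_circleMap_lt_one h0.le h1 θ)]
  rw [integralMean, this, eLpNorm_const _ (by positivity)
    (IsProbabilityMeasure.ne_zero angleMeasure)]
  simp

lemma hardyENorm_le_of_norm_le {p : ℝ≥0∞} (hp : 1 ≤ p) {f : 𝔻 → ℂ} {M : ℝ}
    (h : ∀ z, ‖f z‖ ≤ M) : hardyENorm p f ≤ ENNReal.ofReal M := by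
  refine hardyENorm_le_of_integralMean_le fun r h0 h1 => ?_
  refine (integralMean_le_mul (f := fun _ => 1) (M := M) (by simpa using h) h0 h1).trans_eq ?_
  rw [integralMean_const hp 1 h0 h1]
  simp

lemma diffContOnCl_dilate {f : 𝔻 → ℂ} (hf : IsAnalyticOnDisc f) {ρ : ℝ} (h0 : 0 ≤ ρ)
    (h1 : ρ < 1) : DiffContOnCl ℂ (fun z => zeroExt f (ρ * z)) (Metric.ball 0 1) := by
  refine DifferentiableOn.diffContOnCl ?_
  refine DifferentiableOn.comp hf (t := Metric.ball 0 1) (by fun_prop) fun z hz => ?_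
  rw [closure_ball _ one_ne_zero] at hz
  have hz' : ‖z‖ ≤ 1 := by simpa using hz
  simp only [Metric.mem_ball, dist_zero_right, norm_mul, Complex.norm_real, Real.norm_eq_abs,
    abs_of_nonneg h0]
  nlinarith

lemma mul_circleMap_zero (ρ r θ : ℝ) : (ρ : ℂ) * circleMap 0 r θ = circleMap 0 (ρ * r) θ := by
  simp [circleMap, mul_assoc]

/-- Littlewood subordination for the means of `f ∘ ψ`, bounded by the Hardy norm of `f`. -/
lemma integralMean_comp_le {p : ℝ≥0∞} (hp : 1 ≤ p) (hp' : p ≠ ∞) {f : 𝔻 → ℂ}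
    (hf : IsAnalyticOnDisc f) {ψ : 𝔻 → 𝔻} (hψ : IsAnalyticOnDisc fun z => (ψ z : ℂ)) {r : ℝ}
    (h0 : 0 < r) (h1 : r < 1) :
    integralMean p (fun z => f (ψ z)) r ≤
      ENNReal.ofReal ((1 + ‖(ψ 0 : ℂ)‖) / (1 - ‖(ψ 0 : ℂ)‖)) ^ (1 / p.toReal) *
        hardyENorm p f := by
  set K := ENNReal.ofReal ((1 + ‖(ψ 0 : ℂ)‖) / (1 - ‖(ψ 0 : ℂ)‖)) ^ (1 / p.toReal) with hK
  have hKtop : K ≠ ∞ := ENNReal.rpow_ne_top_of_nonneg (by positivity) ENNReal.ofReal_ne_top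
  rw [hardyENorm, ← ENNReal.limsup_const_mul_of_ne_top hKtop]
  -- Fatou's lemma along the radii `1 - 1 / (n + 1)`, applied to the dilations of `f`.
  set ρ : ℕ → ℝ := fun n => 1 - 1 / ((n : ℝ) + 1) with hρ
  have hρlt (n : ℕ) : ρ n < 1 := by
    have : 0 < 1 / ((n : ℝ) + 1) := by positivity
    simp only [hρ]; linarith
  have hρ0 (n : ℕ) : 0 ≤ ρ n := by
    have : 1 / ((n : ℝ) + 1) ≤ 1 := by
      rw [div_le_one (by positivity)]
      have : (0 : ℝ) ≤ n := by positivity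
      linarith
    simp only [hρ]; linarith
  have hρ1 : Tendsto ρ atTop (𝓝 1) := by
    have := (tendsto_const_nhds (x := (1 : ℝ))).sub
      (tendsto_one_div_add_atTop_nhds_zero_nat (𝕜 := ℝ))
    rwa [sub_zero] at this
  have hρlim : Tendsto ρ atTop (𝓝[<] 1) :=
    tendsto_nhdsWithin_iff.2 ⟨hρ1, Eventually.of_forall hρlt⟩
  set w : ℝ → 𝔻 := fun θ => ψ (Complex.UnitDisc.mk _ (norm_circleMap_lt_one h0.le h1 θ))
  have hzero (z : ℂ) (hz : ‖z‖ < 1) : ‖zeroExt (fun z => (ψ z : ℂ)) z‖ < 1 := by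
    rw [zeroExt_apply _ hz]
    exact (ψ _).norm_lt_one
  have hz0 : zeroExt (fun z => (ψ z : ℂ)) 0 = ψ 0 := by
    rw [← Complex.UnitDisc.coe_zero, zeroExt_coe]
  have hwext (θ : ℝ) : zeroExt (fun z => (ψ z : ℂ)) (circleMap 0 r θ) = w θ := by
    rw [zeroExt_apply _ (norm_circleMap_lt_one h0.le h1 θ)]
  have hb (n : ℕ) : eLpNorm (fun θ => zeroExt f (ρ n * w θ)) p angleMeasure ≤
      K * integralMean p f (ρ n) := by
    have := eLpNorm_comp_circleMap_le hp hp' (diffContOnCl_dilate hf (hρ0 n) (hρlt n)) hψ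
      hzero h0.le h1
    simp only [hwext, hz0, mul_circleMap_zero, mul_one] at this
    exact this
  have hwc : Continuous fun θ => (w θ : ℂ) := by
    have := DifferentiableOn.continuousOn hψ |>.comp_continuous (continuous_circleMap 0 r)
      fun θ => by simpa using norm_circleMap_lt_one h0.le h1 θ
    simpa only [Function.comp_def, hwext] using this
  have hmeas (n : ℕ) : AEStronglyMeasurable (fun θ => zeroExt f (ρ n * w θ)) angleMeasure := by
    refine Continuous.aestronglyMeasurable ?_
    refine (diffContOnCl_dilate hf (hρ0 n) (hρlt n)).differentiableOn.continuousOn.comp_continuous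
      hwc fun θ => ?_
    simpa using (w θ).norm_lt_one
  have hlim (θ : ℝ) : Tendsto (fun n => zeroExt f (ρ n * w θ)) atTop
      (𝓝 (zeroExt (fun z => f (ψ z)) (circleMap 0 r θ))) := by
    rw [zeroExt_apply _ (norm_circleMap_lt_one h0.le h1 θ)]
    have hc : ContinuousAt (zeroExt f) (w θ) :=
      (DifferentiableOn.continuousOn hf).continuousAt
        (Metric.isOpen_ball.mem_nhds (by simpa using (w θ).norm_lt_one))
    have hρC : Tendsto (fun n => (ρ n : ℂ) * w θ) atTop (𝓝 (w θ)) := by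
      have := ((Complex.continuous_ofReal.tendsto 1).comp hρ1).mul_const (w θ : ℂ)
      simpa using this
    have := hc.tendsto.comp hρC
    rwa [zeroExt_coe] at this
  refine (Lp.eLpNorm_lim_le_liminf_eLpNorm hmeas _ (ae_of_all _ hlim)).trans ?_
  refine (liminf_le_liminf (Eventually.of_forall hb)).trans
    ((liminf_le_limsup (f := atTop)).trans ?_)
  exact limsup_le_limsup_of_le (f := map ρ atTop) (u := fun r => K * integralMean p f r) hρlim
    (by isBoundedDefault) (by isBoundedDefault)

lemma hardyENorm_comp_le {p : ℝ≥0∞} (hp : 1 ≤ p) (hp' : p ≠ ∞) {f : 𝔻 → ℂ}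
    (hf : IsAnalyticOnDisc f) {ψ : 𝔻 → 𝔻} (hψ : IsAnalyticOnDisc fun z => (ψ z : ℂ)) :
    hardyENorm p (fun z => f (ψ z)) ≤
      ENNReal.ofReal ((1 + ‖(ψ 0 : ℂ)‖) / (1 - ‖(ψ 0 : ℂ)‖)) ^ (1 / p.toReal) *
        hardyENorm p f :=
  hardyENorm_le_of_integralMean_le fun _ h0 h1 => integralMean_comp_le hp hp' hf hψ h0 h1

lemma integralMean_le_hardyENorm {p : ℝ≥0∞} (hp : 1 ≤ p) (hp' : p ≠ ∞) {f : 𝔻 → ℂ}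
    (hf : IsAnalyticOnDisc f) {r : ℝ} (h0 : 0 < r) (h1 : r < 1) :
    integralMean p f r ≤ hardyENorm p f := by
  simpa using integralMean_comp_le hp hp' hf (ψ := id) isAnalyticOnDisc_coeFun h0 h1

/-- The point evaluation at `w` is bounded on `H^p`: subordination for the constant map `w`. -/
lemma enorm_apply_le {p : ℝ≥0∞} (hp : 1 ≤ p) (hp' : p ≠ ∞) {f : 𝔻 → ℂ}
    (hf : IsAnalyticOnDisc f) (w : 𝔻) :
    ‖f w‖ₑ ≤ ENNReal.ofReal ((1 + ‖(w : ℂ)‖) / (1 - ‖(w : ℂ)‖)) ^ (1 / p.toReal) *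
        hardyENorm p f := by
  have h := integralMean_comp_le hp hp' hf (ψ := fun _ => w)
    (isAnalyticOnDisc_coe (F := fun _ => (w : ℂ)) (differentiableOn_const _))
    (r := 1 / 2) (by norm_num) (by norm_num)
  rwa [integralMean_const hp _ (by norm_num) (by norm_num)] at h

lemma integralMean_mono {p : ℝ≥0∞} (hp : 1 ≤ p) (hp' : p ≠ ∞) {f : 𝔻 → ℂ}
    (hf : IsAnalyticOnDisc f) {r ρ : ℝ} (h0 : 0 < r) (h1 : r < ρ) (h2 : ρ < 1) :
    integralMean p f r ≤ integralMean p f ρ := by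
  have hρ : 0 < ρ := h0.trans h1
  have h := eLpNorm_comp_circleMap_le hp hp' (diffContOnCl_dilate hf hρ.le h2)
    (Ψ := fun z => z) differentiableOn_id (fun _ h => h) (r := r / ρ) (by positivity)
    ((div_lt_one hρ).2 h1)
  simpa [mul_circleMap_zero, mul_div_cancel₀ _ hρ.ne', integralMean] using h

/-- Fatou's lemma for the Hardy norm. -/
lemma hardyENorm_le_of_tendsto {p : ℝ≥0∞} (hp : 1 ≤ p) (hp' : p ≠ ∞) {g : ℕ → 𝔻 → ℂ} {f : 𝔻 → ℂ}
    (hg : ∀ n, IsAnalyticOnDisc (g n)) (hlim : ∀ z, Tendsto (fun n => g n z) atTop (𝓝 (f z)))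
    {K : ℝ≥0∞} (hK : ∀ᶠ n in atTop, hardyENorm p (g n) ≤ K) : hardyENorm p f ≤ K := by
  refine hardyENorm_le_of_integralMean_le fun r h0 h1 => ?_
  refine (Lp.eLpNorm_lim_le_liminf_eLpNorm (f := fun n θ => zeroExt (g n) (circleMap 0 r θ))
    (fun n => (continuous_circle (hg n) h0 h1).aestronglyMeasurable) _
    (ae_of_all _ fun θ => ?_)).trans ?_
  · simp only [zeroExt_apply _ (norm_circleMap_lt_one h0.le h1 θ)]
    exact hlim _
  · refine liminf_le_of_frequently_le' (Eventually.frequently ?_)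
    filter_upwards [hK] with n hn
    exact (integralMean_le_hardyENorm hp hp' (hg n) h0 h1).trans hn

/-! ### The Hardy space as a Banach space -/

namespace HardySpace

variable {p : ℝ≥0∞} [hp : Fact (1 ≤ p)]

lemma isAnalytic (f : HardySpace p) : IsAnalyticOnDisc f := f.2.1

lemma hardyENorm_lt_top (f : HardySpace p) : hardyENorm p f < ∞ := f.2.2

/-- The element of `H^p` given by an analytic function with finite Hardy norm. -/
def ofFun (f : 𝔻 → ℂ) (hf : IsAnalyticOnDisc f) (hfin : hardyENorm p f < ∞) : HardySpace p :=
  ⟨f, hf, hfin⟩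

@[simp] lemma ofFun_apply (f : 𝔻 → ℂ) (hf : IsAnalyticOnDisc f) (hfin : hardyENorm p f < ∞)
    (z : 𝔻) : ofFun f hf hfin z = f z := rfl

lemma ext_apply {f g : HardySpace p} (h : ∀ z : 𝔻, f z = g z) : f = g :=
  Subtype.ext (funext h)

lemma add_apply (f g : HardySpace p) (z : 𝔻) : (f + g) z = f z + g z := rfl

lemma smul_apply (c : ℂ) (f : HardySpace p) (z : 𝔻) : (c • f) z = c * f z := rfl

lemma sub_apply (f g : HardySpace p) (z : 𝔻) : (f - g) z = f z - g z := rfl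

lemma zero_apply (z : 𝔻) : (0 : HardySpace p) z = 0 := rfl

lemma norm_def (f : HardySpace p) : ‖f‖ = (hardyENorm p f).toReal := rfl

lemma ofReal_norm_eq (f : HardySpace p) : ENNReal.ofReal ‖f‖ = hardyENorm p f :=
  ENNReal.ofReal_toReal f.hardyENorm_lt_top.ne

lemma norm_le_of_hardyENorm_le {f : HardySpace p} {M : ℝ} (hM : 0 ≤ M)
    (h : hardyENorm p f ≤ ENNReal.ofReal M) : ‖f‖ ≤ M :=
  ENNReal.toReal_le_of_le_ofReal hM h

lemma subordination_const_nonneg (w : 𝔻) : 0 ≤ (1 + ‖(w : ℂ)‖) / (1 - ‖(w : ℂ)‖) :=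
  div_nonneg (by positivity) (by linarith [w.norm_lt_one])

lemma norm_apply_le (hp' : p ≠ ∞) (f : HardySpace p) (w : 𝔻) :
    ‖f w‖ ≤ ((1 + ‖(w : ℂ)‖) / (1 - ‖(w : ℂ)‖)) ^ (1 / p.toReal) * ‖f‖ := by
  have h := enorm_apply_le hp.out hp' f.isAnalytic w
  rw [← f.ofReal_norm_eq,
    ENNReal.ofReal_rpow_of_nonneg (subordination_const_nonneg w) (by positivity),
    ← ENNReal.ofReal_mul (by have := subordination_const_nonneg w; positivity), ← ofReal_norm,
    ENNReal.ofReal_le_ofReal_iff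
      (by have := subordination_const_nonneg w; positivity)] at h
  exact h

/-- Evaluation at a point of the disc, as a continuous linear functional on `H^p`. -/
def evalCLM (hp' : p ≠ ∞) (w : 𝔻) : HardySpace p →L[ℂ] ℂ :=
  LinearMap.mkContinuous
    { toFun := fun f => f w
      map_add' := fun _ _ => rfl
      map_smul' := fun _ _ => rfl } _ fun f => norm_apply_le hp' f w

@[simp] lemma evalCLM_apply (hp' : p ≠ ∞) (w : 𝔻) (f : HardySpace p) : evalCLM hp' w f = f w := rfl

/-- The composition operator `f ↦ f ∘ ψ` of an analytic self-map of the disc. -/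
def compCLM (hp' : p ≠ ∞) (ψ : 𝔻 → 𝔻) (hψ : IsAnalyticOnDisc fun z => (ψ z : ℂ)) :
    HardySpace p →L[ℂ] HardySpace p :=
  LinearMap.mkContinuous
    { toFun := fun f => ofFun (fun z => f (ψ z)) (f.isAnalytic.comp hψ)
        ((hardyENorm_comp_le hp.out hp' f.isAnalytic hψ).trans_lt (ENNReal.mul_lt_top
          (ENNReal.rpow_lt_top_of_nonneg (by positivity) ENNReal.ofReal_ne_top)
          f.hardyENorm_lt_top))
      map_add' := fun _ _ => rfl
      map_smul' := fun _ _ => rfl }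
    (((1 + ‖(ψ 0 : ℂ)‖) / (1 - ‖(ψ 0 : ℂ)‖)) ^ (1 / p.toReal)) fun f => by
      have h0 := subordination_const_nonneg (ψ 0)
      refine norm_le_of_hardyENorm_le (by positivity) ?_
      rw [ENNReal.ofReal_mul (by positivity), f.ofReal_norm_eq,
        ← ENNReal.ofReal_rpow_of_nonneg h0 (by positivity)]
      exact hardyENorm_comp_le hp.out hp' f.isAnalytic hψ

lemma norm_compCLM_le (hp' : p ≠ ∞) (ψ : 𝔻 → 𝔻) (hψ : IsAnalyticOnDisc fun z => (ψ z : ℂ)) :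
    ‖compCLM hp' ψ hψ‖ ≤ ((1 + ‖(ψ 0 : ℂ)‖) / (1 - ‖(ψ 0 : ℂ)‖)) ^ (1 / p.toReal) :=
  LinearMap.mkContinuous_norm_le _ (by have := subordination_const_nonneg (ψ 0); positivity) _

/-- `H^p` is complete: Cauchy sequences converge locally uniformly by the bounds on point
evaluations, and Fatou's lemma identifies the limit as a limit in norm. -/
lemma completeSpace (hp' : p ≠ ∞) : CompleteSpace (HardySpace p) := by
  refine Metric.complete_of_cauchySeq_tendsto fun u hu => ?_
  have hpt (z : 𝔻) : ∃ l, Tendsto (fun n => u n z) atTop (𝓝 l) :=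
    cauchySeq_tendsto_of_complete ((evalCLM hp' z).uniformContinuous.comp_cauchySeq hu)
  choose g hg using hpt
  have hext (n : ℕ) (z : ℂ) (hz : ‖z‖ < 1) :
      zeroExt (u n) z = u n (Complex.UnitDisc.mk z hz) := zeroExt_apply _ hz
  have hunif (s : ℝ) (hs : s < 1) :
      TendstoUniformlyOn (fun n => zeroExt (u n)) (zeroExt g) atTop (Metric.closedBall 0 s) := by
    refine UniformCauchySeqOn.tendstoUniformlyOn_of_tendsto ?_ fun z hz => ?_
    · rw [Metric.uniformCauchySeqOn_iff]
      intro ε hε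
      rcases lt_or_ge s 0 with hs0 | hs0
      · exact ⟨0, fun m _ n _ z hz => by
          simp only [Metric.closedBall_eq_empty.2 hs0, Set.mem_empty_iff_false] at hz⟩
      set K : ℝ := ((1 + s) / (1 - s)) ^ (1 / p.toReal)
      have hK : 0 < K := Real.rpow_pos_of_pos (div_pos (by linarith) (by linarith)) _
      obtain ⟨N, hN⟩ := Metric.cauchySeq_iff.1 hu (ε / K) (by positivity)
      refine ⟨N, fun m hm n hn z hz => ?_⟩
      have hzs : ‖z‖ ≤ s := by simpa using hz
      have hz1 : ‖z‖ < 1 := hzs.trans_lt hs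
      rw [hext m z hz1, hext n z hz1, dist_eq_norm, ← sub_apply]
      refine (norm_apply_le hp' _ _).trans_lt ?_
      have h1 := hN m hm n hn
      rw [dist_eq_norm, lt_div_iff₀' hK] at h1
      refine lt_of_le_of_lt ?_ h1
      refine mul_le_mul_of_nonneg_right (Real.rpow_le_rpow
        (subordination_const_nonneg _) ?_ (by positivity)) (norm_nonneg _)
      rw [Complex.UnitDisc.coe_mk]
      exact div_le_div₀ (by linarith) (by linarith) (by linarith) (by linarith)
    · have hz1 : ‖z‖ < 1 := lt_of_le_of_lt (by simpa using hz) hs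
      simp only [zeroExt_apply _ hz1]
      exact hg _
  have hga : IsAnalyticOnDisc g := by
    have hloc : TendstoLocallyUniformlyOn (fun n => zeroExt (u n)) (zeroExt g) atTop
        (Metric.ball 0 1) := by
      rw [Metric.tendstoLocallyUniformlyOn_iff]
      intro ε hε z hz
      have hz1 : ‖z‖ < 1 := by simpa using hz
      refine ⟨Metric.ball 0 ((1 + ‖z‖) / 2), mem_nhdsWithin_of_mem_nhds
        (Metric.isOpen_ball.mem_nhds (by simp; linarith)), ?_⟩
      filter_upwards [Metric.tendstoUniformlyOn_iff.1
        (hunif ((1 + ‖z‖) / 2) (by linarith)) ε hε] with n hn y hy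
      exact hn y (Metric.ball_subset_closedBall hy)
    exact hloc.differentiableOn (Eventually.of_forall fun n => (u n).isAnalytic)
      Metric.isOpen_ball
  have hga_sub (n : ℕ) : IsAnalyticOnDisc fun z => u n z - g z := by
    have : (fun z => u n z - g z) = (u n : 𝔻 → ℂ) + (-1 : ℂ) • g := by
      funext z; simp [sub_eq_add_neg]
    rw [this, IsAnalyticOnDisc, zeroExt_add, zeroExt_smul]
    exact (u n).isAnalytic.add (hga.const_smul _)
  have hbound (ε : ℝ) (hε : 0 < ε) : ∃ N, ∀ n ≥ N,
      hardyENorm p (fun z => u n z - g z) ≤ ENNReal.ofReal ε := by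
    obtain ⟨N, hN⟩ := Metric.cauchySeq_iff.1 hu ε hε
    refine ⟨N, fun n hn => ?_⟩
    refine hardyENorm_le_of_tendsto hp.out hp' (g := fun m => (u n - u m : HardySpace p))
      (fun m => (u n - u m).isAnalytic) (fun z => (hg z).const_sub _) ?_
    filter_upwards [eventually_ge_atTop N] with m hm
    rw [← ofReal_norm_eq, ← dist_eq_norm]
    exact ENNReal.ofReal_le_ofReal (hN n hn m hm).le
  obtain ⟨N₀, hN₀⟩ := hbound 1 one_pos
  set d : HardySpace p := ofFun (fun z => u N₀ z - g z) (hga_sub N₀)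
    ((hN₀ N₀ le_rfl).trans_lt ENNReal.ofReal_lt_top)
  refine ⟨u N₀ - d, Metric.tendsto_atTop.2 fun ε hε => ?_⟩
  obtain ⟨N, hN⟩ := hbound (ε / 2) (by positivity)
  refine ⟨N, fun n hn => ?_⟩
  rw [dist_eq_norm]
  refine lt_of_le_of_lt (norm_le_of_hardyENorm_le (by positivity) ?_) (half_lt_self hε)
  have : ((u n - (u N₀ - d) : HardySpace p) : 𝔻 → ℂ) = fun z => u n z - g z := by
    funext z
    simp only [sub_apply, d, ofFun_apply]
    ring
  rw [this]
  exact hN n hn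

lemma norm_le_of_norm_apply_le {f : HardySpace p} {M : ℝ} (hM : 0 ≤ M) (h : ∀ z : 𝔻, ‖f z‖ ≤ M) :
    ‖f‖ ≤ M :=
  norm_le_of_hardyENorm_le hM (hardyENorm_le_of_norm_le hp.out h)

lemma norm_le_mul_norm {f g : HardySpace p} {M : ℝ} (hM : 0 ≤ M) (h : ∀ z : 𝔻, ‖g z‖ ≤ M * ‖f z‖) :
    ‖g‖ ≤ M * ‖f‖ := by
  refine norm_le_of_hardyENorm_le (by positivity) ?_
  rw [ENNReal.ofReal_mul hM, ofReal_norm_eq]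
  exact hardyENorm_le_mul h

end HardySpace

/-! ### Convergence of dilations -/

lemma norm_midpoint_rpow_le {q : ℝ} (hq : 1 ≤ q) (a b : ℂ) :
    ‖(a + b) / 2‖ ^ q ≤ (‖a‖ ^ q + ‖b‖ ^ q) / 2 := by
  have h1 : ‖(a + b) / 2‖ ≤ (1 / 2 : ℝ) * ‖a‖ + (1 / 2 : ℝ) * ‖b‖ := by
    rw [norm_div, Complex.norm_ofNat]
    linarith [norm_add_le a b]
  refine (Real.rpow_le_rpow (norm_nonneg _) h1 (by linarith)).trans ?_
  have := (convexOn_rpow hq).2 (Set.mem_Ici.2 (norm_nonneg a)) (Set.mem_Ici.2 (norm_nonneg b))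
    (show (0 : ℝ) ≤ 1 / 2 by norm_num) (show (0 : ℝ) ≤ 1 / 2 by norm_num) (by norm_num)
  simp only [smul_eq_mul] at this
  linarith

lemma norm_midpoint_rpow_lt {q : ℝ} (hq : 1 < q) {a b : ℂ} (hab : a ≠ b) :
    ‖(a + b) / 2‖ ^ q < (‖a‖ ^ q + ‖b‖ ^ q) / 2 := by
  have h1 : ‖(a + b) / 2‖ ≤ (1 / 2 : ℝ) * ‖a‖ + (1 / 2 : ℝ) * ‖b‖ := by
    rw [norm_div, Complex.norm_ofNat]
    linarith [norm_add_le a b]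
  by_cases hn : ‖a‖ = ‖b‖
  · have h2 : ‖(a + b) / 2‖ < ‖a‖ := by
      rw [norm_div, Complex.norm_ofNat, div_lt_iff₀ two_pos]
      refine lt_of_le_of_ne (by linarith [norm_add_le a b]) fun h => hab ?_
      exact eq_of_norm_eq_of_norm_add_eq hn (by linarith)
    calc _ < ‖a‖ ^ q := Real.rpow_lt_rpow (norm_nonneg _) h2 (by linarith)
      _ = _ := by rw [← hn]; ring
  · refine (Real.rpow_le_rpow (norm_nonneg _) h1 (by linarith)).trans_lt ?_
    have := (strictConvexOn_rpow hq).2 (Set.mem_Ici.2 (norm_nonneg a))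
      (Set.mem_Ici.2 (norm_nonneg b)) hn
      (show (0 : ℝ) < 1 / 2 by norm_num) (show (0 : ℝ) < 1 / 2 by norm_num) (by norm_num)
    simp only [smul_eq_mul] at this
    linarith

/-- A pointwise form of the uniform convexity of `L^q`, `q > 1`: the defect in the midpoint
convexity of `|·|^q` controls the distance of the two points. -/
lemma exists_norm_sub_rpow_le {q : ℝ} (hq : 1 < q) {ε : ℝ} (hε : 0 < ε) :
    ∃ C : ℝ, 0 ≤ C ∧ ∀ a b : ℂ, ‖a - b‖ ^ q ≤ ε * (‖a‖ ^ q + ‖b‖ ^ q) +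
      C * ((‖a‖ ^ q + ‖b‖ ^ q) / 2 - ‖(a + b) / 2‖ ^ q) := by
  have hq0 : 0 < q := by linarith
  -- By homogeneity it suffices to consider the unit sphere of `ℂ × ℂ`, which is compact.
  set S : Set (ℂ × ℂ) := Metric.sphere 0 1 ∩ {x | ε ≤ ‖x.1 - x.2‖ ^ q} with hS
  set D : ℂ × ℂ → ℝ := fun x => (‖x.1‖ ^ q + ‖x.2‖ ^ q) / 2 - ‖(x.1 + x.2) / 2‖ ^ q with hD
  have hcont {f : ℂ × ℂ → ℂ} (hf : Continuous f) : Continuous fun x => ‖f x‖ ^ q :=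
    hf.norm.rpow_const fun _ => Or.inr hq0.le
  have hScomp : IsCompact S := (isCompact_sphere _ _).inter_right
    (isClosed_le continuous_const (hcont (continuous_fst.sub continuous_snd)))
  have hDc : Continuous D := (((hcont continuous_fst).add (hcont continuous_snd)).div_const 2).sub
    (hcont ((continuous_fst.add continuous_snd).div_const 2))
  have hDpos : ∀ x ∈ S, 0 < D x := by
    rintro x ⟨-, hx⟩
    have hne : x.1 ≠ x.2 := by
      intro h
      rw [Set.mem_ofPred_eq, h, sub_self, norm_zero, Real.zero_rpow hq0.ne'] at hx
      linarith
    exact sub_pos.2 (norm_midpoint_rpow_lt hq hne)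
  obtain ⟨δ, hδ, hδS⟩ : ∃ δ : ℝ, 0 < δ ∧ ∀ x ∈ S, δ ≤ D x := by
    rcases S.eq_empty_or_nonempty with h | h
    · exact ⟨1, one_pos, by simp [h]⟩
    · obtain ⟨x, hx, hmin⟩ := hScomp.exists_isMinOn h hDc.continuousOn
      exact ⟨D x, hDpos x hx, fun y hy => hmin hy⟩
  have hC : 0 ≤ 2 ^ q / δ := by positivity
  refine ⟨2 ^ q / δ, hC, fun a b => ?_⟩
  have hunit (x : ℂ × ℂ) (hx : ‖x‖ = 1) : ‖x.1 - x.2‖ ^ q ≤ ε * (‖x.1‖ ^ q + ‖x.2‖ ^ q) +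
      2 ^ q / δ * D x := by
    have hD0 : 0 ≤ D x := sub_nonneg.2 (norm_midpoint_rpow_le hq.le _ _)
    have h1 : ‖x.1‖ ≤ 1 := (norm_fst_le x).trans_eq hx
    have h2 : ‖x.2‖ ≤ 1 := (norm_snd_le x).trans_eq hx
    have hn1 : 0 ≤ ‖x.1‖ ^ q := by positivity
    have hn2 : 0 ≤ ‖x.2‖ ^ q := by positivity
    have hsum : 1 ≤ ‖x.1‖ ^ q + ‖x.2‖ ^ q := by
      have : ‖x.1‖ = 1 ∨ ‖x.2‖ = 1 := by
        rw [Prod.norm_def] at hx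
        rcases max_choice ‖x.1‖ ‖x.2‖ with h | h
        · exact Or.inl (h ▸ hx)
        · exact Or.inr (h ▸ hx)
      rcases this with h | h <;> rw [h, Real.one_rpow] <;> linarith
    by_cases hx' : ε ≤ ‖x.1 - x.2‖ ^ q
    · have h3 : ‖x.1 - x.2‖ ^ q ≤ 2 ^ q :=
        Real.rpow_le_rpow (norm_nonneg _) (by linarith [norm_sub_le x.1 x.2]) hq0.le
      have h4 : 2 ^ q ≤ 2 ^ q / δ * D x := by
        calc (2 : ℝ) ^ q = 2 ^ q / δ * δ := by field_simp
          _ ≤ _ := mul_le_mul_of_nonneg_left (hδS x ⟨by simpa using hx, hx'⟩) hC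
      nlinarith
    · nlinarith [mul_nonneg hC hD0]
  set s : ℝ := ‖(a, b)‖ with hs
  rcases (norm_nonneg (a, b)).eq_or_lt with h0 | h0
  · have hab : (a, b) = 0 := norm_eq_zero.1 h0.symm
    obtain ⟨rfl, rfl⟩ := Prod.mk_eq_zero.1 hab
    simp [Real.zero_rpow hq0.ne']
  have hsc : (s : ℂ) ≠ 0 := Complex.ofReal_ne_zero.2 h0.ne'
  have hscale (z : ℂ) : ‖z‖ ^ q = s ^ q * ‖z / s‖ ^ q := by
    rw [← Real.mul_rpow h0.le (norm_nonneg _), norm_div, Complex.norm_real, Real.norm_eq_abs,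
      abs_of_pos h0, mul_div_cancel₀ _ h0.ne']
  have h := hunit (a / s, b / s) (by
    rw [Prod.norm_def, norm_div, norm_div, Complex.norm_real, Real.norm_eq_abs, abs_of_pos h0,
      max_div_div_right h0.le, ← Prod.norm_mk, ← hs, div_self h0.ne'])
  have h' := mul_le_mul_of_nonneg_left h (Real.rpow_nonneg h0.le q)
  simp only [hD] at h'
  rw [hscale a, hscale b, hscale (a - b), hscale ((a + b) / 2), sub_div,
    show (a + b) / 2 / (s : ℂ) = (a / s + b / s) / 2 by field_simp]
  linarith

section Dilation

variable {p : ℝ≥0∞}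

lemma toReal_integralMean_rpow (hp : 1 ≤ p) (hp' : p ≠ ∞) {f : 𝔻 → ℂ} (hf : IsAnalyticOnDisc f)
    {r : ℝ} (h0 : 0 < r) (h1 : r < 1) :
    (integralMean p f r).toReal ^ p.toReal =
      ∫ θ, ‖zeroExt f (circleMap 0 r θ)‖ ^ p.toReal ∂angleMeasure := by
  have hq : 0 < p.toReal := ENNReal.toReal_pos (by positivity) hp'
  have hc := continuous_circle hf h0 h1
  have hmem : MemLp (fun θ : ℝ => zeroExt f (circleMap 0 r θ)) p angleMeasure := by
    refine ⟨hc.aestronglyMeasurable, ?_⟩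
    rw [eLpNorm_lt_top_iff_lintegral_rpow_enorm_lt_top (by positivity) hp']
    have := (integrable_angleMeasure (hc.norm.rpow_const fun _ => Or.inr hq.le)).2
    rw [hasFiniteIntegral_iff_enorm] at this
    refine lt_of_eq_of_lt (lintegral_congr fun θ => ?_) this
    rw [Real.enorm_rpow_of_nonneg (norm_nonneg _) hq.le, enorm_norm]
  rw [integralMean, hmem.eLpNorm_eq_integral_rpow_norm (by positivity) hp',
    ENNReal.toReal_ofReal (by positivity), ← Real.rpow_mul (by positivity),
    inv_mul_cancel₀ hq.ne', Real.rpow_one]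

/-- The dilation `z ↦ f (r z)` of a function on the disc. -/
def dilate (f : 𝔻 → ℂ) (r : ℝ) : 𝔻 → ℂ := fun z => zeroExt f (r * z)

lemma zeroExt_dilate (f : 𝔻 → ℂ) (r : ℝ) {z : ℂ} (hz : ‖z‖ < 1) :
    zeroExt (dilate f r) z = zeroExt f (r * z) := by
  rw [zeroExt_apply _ hz, dilate, Complex.UnitDisc.coe_mk]

lemma isAnalyticOnDisc_dilate {f : 𝔻 → ℂ} (hf : IsAnalyticOnDisc f) {r : ℝ} (h0 : 0 ≤ r)
    (h1 : r < 1) : IsAnalyticOnDisc (dilate f r) :=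
  isAnalyticOnDisc_coe (diffContOnCl_dilate hf h0 h1).differentiableOn

lemma integralMean_dilate (f : 𝔻 → ℂ) (r : ℝ) {ρ : ℝ} (h0 : 0 < ρ) (h1 : ρ < 1) :
    integralMean p (dilate f r) ρ = integralMean p f (r * ρ) := by
  simp only [integralMean, zeroExt_dilate f r (norm_circleMap_lt_one h0.le h1 _),
    mul_circleMap_zero]

/-- As `r → 1`, the midpoints of `f` and its dilations have the same means as `f` in the limit. -/
lemma tendsto_integral_midpoint_dilate {q : ℝ} (hq : 0 ≤ q) {f : 𝔻 → ℂ} (hf : IsAnalyticOnDisc f)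
    {τ : ℝ} (h0 : 0 < τ) (h1 : τ < 1) :
    Tendsto (fun r : ℝ => ∫ θ, ‖(zeroExt f (circleMap 0 τ θ) +
        zeroExt (dilate f r) (circleMap 0 τ θ)) / 2‖ ^ q ∂angleMeasure) (𝓝[<] 1)
      (𝓝 (∫ θ, ‖zeroExt f (circleMap 0 τ θ)‖ ^ q ∂angleMeasure)) := by
  have hsub : Metric.closedBall (0 : ℂ) τ ⊆ Metric.ball 0 1 := Metric.closedBall_subset_ball h1
  obtain ⟨B, hB⟩ := (isCompact_closedBall (0 : ℂ) τ).exists_bound_of_continuousOn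
    (DifferentiableOn.continuousOn hf |>.mono hsub)
  have hcirc (θ : ℝ) : circleMap 0 τ θ ∈ Metric.closedBall (0 : ℂ) τ := by
    simp [abs_of_pos h0]
  have hcirc' {r : ℝ} (hr : 0 < r ∧ r < 1) (θ : ℝ) :
      (r : ℂ) * circleMap 0 τ θ ∈ Metric.closedBall (0 : ℂ) τ := by
    simp only [mem_closedBall_zero_iff, norm_mul, Complex.norm_real, Real.norm_eq_abs,
      abs_of_pos hr.1, norm_circleMap_zero, abs_of_pos h0]
    nlinarith [hr.2]
  refine tendsto_integral_filter_of_dominated_convergence (fun _ => B ^ q) ?_ ?_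
    (integrable_const _) (ae_of_all _ fun θ => ?_)
  · filter_upwards [eventually_radius] with r hr
    refine Continuous.aestronglyMeasurable ?_
    exact (((continuous_circle hf h0 h1).add (continuous_circle
      (isAnalyticOnDisc_dilate hf hr.1.le hr.2) h0 h1)).div_const 2).norm.rpow_const
        fun _ => Or.inr hq
  · filter_upwards [eventually_radius] with r hr
    refine ae_of_all _ fun θ => ?_
    rw [Real.norm_of_nonneg (by positivity), zeroExt_dilate f r (norm_circleMap_lt_one h0.le h1 θ)]
    refine Real.rpow_le_rpow (norm_nonneg _) ?_ hq
    rw [norm_div, Complex.norm_ofNat, div_le_iff₀ two_pos]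
    linarith [norm_add_le (zeroExt f (circleMap 0 τ θ)) (zeroExt f (r * circleMap 0 τ θ)),
      hB _ (hcirc θ), hB _ (hcirc' hr θ)]
  · have hc : ContinuousAt (zeroExt f) (circleMap 0 τ θ) :=
      (DifferentiableOn.continuousOn hf).continuousAt
        (Metric.isOpen_ball.mem_nhds (hsub (hcirc θ)))
    have hr : Tendsto (fun r : ℝ => (r : ℂ) * circleMap 0 τ θ) (𝓝[<] 1) (𝓝 (circleMap 0 τ θ)) := by
      have : Continuous fun r : ℝ => (r : ℂ) * circleMap 0 τ θ := by fun_prop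
      simpa using (this.tendsto 1).mono_left nhdsWithin_le_nhds
    have h2 : Tendsto (fun r : ℝ => zeroExt (dilate f r) (circleMap 0 τ θ)) (𝓝[<] 1)
        (𝓝 (zeroExt f (circleMap 0 τ θ))) := by
      simp only [zeroExt_dilate f _ (norm_circleMap_lt_one h0.le h1 θ)]
      exact hc.tendsto.comp hr
    have h3 := ((h2.const_add (zeroExt f (circleMap 0 τ θ))).div_const 2).norm.rpow_const
      (Or.inr hq)
    simpa using h3

/-- For `1 < p < ∞` every `f ∈ H^p` is approximated in norm by its dilations. The means of the
midpoints of `f` and `f_r` come close to the norm of `f`, so uniform convexity applies. -/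
lemma exists_hardyENorm_sub_dilate_le (hp : 1 < p) (hp' : p ≠ ∞) {f : 𝔻 → ℂ}
    (hf : IsAnalyticOnDisc f) (hfin : hardyENorm p f < ∞) {η : ℝ} (hη : 0 < η) :
    ∃ r : ℝ, 0 < r ∧ r < 1 ∧
      hardyENorm p (fun z => f z - dilate f r z) ≤ ENNReal.ofReal (η ^ (1 / p.toReal)) := by
  have hq : 1 < p.toReal := by
    rwa [← ENNReal.toReal_one, ENNReal.toReal_lt_toReal ENNReal.one_ne_top hp']
  have hq0 : 0 < p.toReal := by linarith
  set A : ℝ := (hardyENorm p f).toReal ^ p.toReal with hA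
  have hA0 : 0 ≤ A := by positivity
  set N : (𝔻 → ℂ) → ℝ → ℝ := fun g r => ∫ θ, ‖zeroExt g (circleMap 0 r θ)‖ ^ p.toReal ∂angleMeasure
    with hN
  have hNeq {g : 𝔻 → ℂ} (hg : IsAnalyticOnDisc g) {r : ℝ} (h0 : 0 < r) (h1 : r < 1) :
      (integralMean p g r).toReal ^ p.toReal = N g r :=
    toReal_integralMean_rpow hp.le hp' hg h0 h1
  have hNle {r : ℝ} (h0 : 0 < r) (h1 : r < 1) : N f r ≤ A := by
    rw [← hNeq hf h0 h1]
    exact Real.rpow_le_rpow ENNReal.toReal_nonneg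
      (ENNReal.toReal_mono hfin.ne (integralMean_le_hardyENorm hp.le hp' hf h0 h1)) hq0.le
  have hMfin {g : 𝔻 → ℂ} (hg : IsAnalyticOnDisc g) {r : ℝ} (h0 : 0 < r) (h1 : r < 1) :
      integralMean p g r < ∞ := by
    obtain ⟨B, hB⟩ := (isCompact_closedBall (0 : ℂ) r).exists_bound_of_continuousOn
      (DifferentiableOn.continuousOn hg |>.mono (Metric.closedBall_subset_ball h1))
    refine (eLpNorm_le_of_ae_bound (C := B) (ae_of_all _ fun θ => hB _ ?_)).trans_lt ?_
    · simp [abs_of_pos h0]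
    · simp
  obtain ⟨C, hC0, hC⟩ := exists_norm_sub_rpow_le hq (ε := η / (4 * (A + 1))) (by positivity)
  set δ : ℝ := η / (2 * (C + 1)) with hδ
  have hδ0 : 0 < δ := by positivity
  obtain ⟨τ, hτ0, hτ1, hτ⟩ : ∃ τ : ℝ, 0 < τ ∧ τ < 1 ∧ A - δ < N f τ := by
    by_contra! hcon
    have hAδ : 0 ≤ A - δ := (integral_nonneg fun θ => by positivity).trans
      (hcon (1 / 2) (by norm_num) (by norm_num))
    have h1 : hardyENorm p f ≤ ENNReal.ofReal ((A - δ) ^ (1 / p.toReal)) := by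
      refine hardyENorm_le_of_integralMean_le fun r h0 h1 => ?_
      rw [ENNReal.le_ofReal_iff_toReal_le (hMfin hf h0 h1).ne (by positivity), one_div,
        Real.le_rpow_inv_iff_of_pos ENNReal.toReal_nonneg hAδ hq0, hNeq hf h0 h1]
      exact hcon r h0 h1
    rw [ENNReal.le_ofReal_iff_toReal_le hfin.ne (by positivity), one_div,
      Real.le_rpow_inv_iff_of_pos ENNReal.toReal_nonneg hAδ hq0] at h1
    linarith
  obtain ⟨r, hrmid, hr0, hr1⟩ := (((tendsto_integral_midpoint_dilate hq0.le hf hτ0 hτ1).eventually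
    (lt_mem_nhds hτ)).and eventually_radius).exists
  have hdil := isAnalyticOnDisc_dilate hf hr0.le hr1
  have hsuba : IsAnalyticOnDisc fun z => f z - dilate f r z := by
    have : (fun z => f z - dilate f r z) = f + (-1 : ℂ) • dilate f r := by
      funext z; simp [sub_eq_add_neg]
    rw [this, IsAnalyticOnDisc, zeroExt_add, zeroExt_smul]
    exact hf.add (hdil.const_smul _)
  set m : 𝔻 → ℂ := fun z => (f z + dilate f r z) / 2 with hm
  have hma : IsAnalyticOnDisc m := by
    have : m = (1 / 2 : ℂ) • (f + dilate f r) := by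
      funext z
      simp only [hm, Pi.smul_apply, Pi.add_apply, smul_eq_mul]
      ring
    rw [this, IsAnalyticOnDisc, zeroExt_smul, zeroExt_add]
    exact (hf.add hdil).const_smul _
  have hext {z : ℂ} (hz : ‖z‖ < 1) :
      zeroExt m z = (zeroExt f z + zeroExt (dilate f r) z) / 2 := by
    simp only [zeroExt_apply _ hz, hm]
  refine ⟨r, hr0, hr1, limsup_le_of_le (by isBoundedDefault) ?_⟩
  filter_upwards [Ioo_mem_nhdsLT hτ1] with ρ hρ
  have hρ0 : 0 < ρ := hτ0.trans hρ.1
  have hmτ : A - δ < N m ρ := by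
    have h1 : N m τ ≤ N m ρ := by
      rw [← hNeq hma hτ0 hτ1, ← hNeq hma hρ0 hρ.2]
      exact Real.rpow_le_rpow ENNReal.toReal_nonneg (ENNReal.toReal_mono (hMfin hma hρ0 hρ.2).ne
        (integralMean_mono hp.le hp' hma hτ0 hρ.1 hρ.2)) hq0.le
    refine lt_of_lt_of_le ?_ h1
    simp only [hN, hext (norm_circleMap_lt_one hτ0.le hτ1 _)]
    exact hrmid
  have hdilN : N (dilate f r) ρ ≤ A := by
    rw [← hNeq hdil hρ0 hρ.2, integralMean_dilate f r hρ0 hρ.2,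
      hNeq hf (by positivity) (by nlinarith [hρ.2])]
    exact hNle (by positivity) (by nlinarith [hρ.2])
  have hint {g : 𝔻 → ℂ} (hg : IsAnalyticOnDisc g) :
      Integrable (fun θ : ℝ => ‖zeroExt g (circleMap 0 ρ θ)‖ ^ p.toReal) angleMeasure :=
    integrable_angleMeasure ((continuous_circle hg hρ0 hρ.2).norm.rpow_const
      fun _ => Or.inr hq0.le)
  have hkey : N (fun z => f z - dilate f r z) ρ ≤
      η / (4 * (A + 1)) * (N f ρ + N (dilate f r) ρ) +
        C * ((N f ρ + N (dilate f r) ρ) / 2 - N m ρ) := by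
    set u : ℝ → ℝ := fun θ => ‖zeroExt f (circleMap 0 ρ θ)‖ ^ p.toReal
    set v : ℝ → ℝ := fun θ => ‖zeroExt (dilate f r) (circleMap 0 ρ θ)‖ ^ p.toReal
    set w : ℝ → ℝ := fun θ => ‖zeroExt m (circleMap 0 ρ θ)‖ ^ p.toReal
    have huv : Integrable (fun θ => u θ + v θ) angleMeasure := (hint hf).add (hint hdil)
    have hdef : Integrable (fun θ => (u θ + v θ) / 2 - w θ) angleMeasure :=
      (huv.div_const 2).sub (hint hma)
    have hsplit : ∫ θ, (η / (4 * (A + 1)) * (u θ + v θ) + C * ((u θ + v θ) / 2 - w θ))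
        ∂angleMeasure = η / (4 * (A + 1)) * (N f ρ + N (dilate f r) ρ) +
        C * ((N f ρ + N (dilate f r) ρ) / 2 - N m ρ) := by
      rw [integral_add (huv.const_mul _) (hdef.const_mul _), integral_const_mul,
        integral_const_mul, integral_sub (huv.div_const 2) (hint hma), integral_div,
        integral_add (hint hf) (hint hdil)]
    rw [← hsplit]
    refine integral_mono (hint hsuba) ((huv.const_mul _).add (hdef.const_mul _)) fun θ => ?_
    have hθ := norm_circleMap_lt_one hρ0.le hρ.2 θ
    have h := hC (zeroExt f (circleMap 0 ρ θ)) (zeroExt (dilate f r) (circleMap 0 ρ θ))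
    rw [← hext hθ] at h
    have hs : zeroExt (fun z => f z - dilate f r z) (circleMap 0 ρ θ) =
        zeroExt f (circleMap 0 ρ θ) - zeroExt (dilate f r) (circleMap 0 ρ θ) := by
      simp only [zeroExt_apply _ hθ]
    simp only [hs]
    exact h
  have hfN := hNle hρ0 hρ.2
  have hη1 : η / (4 * (A + 1)) * (N f ρ + N (dilate f r) ρ) ≤ η / 2 := by
    calc _ ≤ η / (4 * (A + 1)) * (2 * (A + 1)) :=
          mul_le_mul_of_nonneg_left (by linarith) (by positivity)
      _ = _ := by field_simp; norm_num
  have hη2 : C * ((N f ρ + N (dilate f r) ρ) / 2 - N m ρ) ≤ η / 2 := by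
    calc _ ≤ (C + 1) * δ := by nlinarith
      _ = _ := by rw [hδ]; field_simp
  change integralMean p _ ρ ≤ _
  rw [ENNReal.le_ofReal_iff_toReal_le (hMfin hsuba hρ0 hρ.2).ne (by positivity), one_div,
    Real.le_rpow_inv_iff_of_pos ENNReal.toReal_nonneg hη.le hq0, hNeq hsuba hρ0 hρ.2]
  linarith

end Dilation

/-! ### The half-plane coordinate of a hyperbolic axis -/

/-- Two points `α`, `β` of the unit circle, together with the constant `c` that makes
`z ↦ c (α - z) / (z - β)` a map of the disc onto the right half-plane `{Re > 0}`. The equation for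
`c` says that the circle is mapped into the imaginary axis; with `0 < Re c` it forces `α ≠ β`. -/
structure Axis where
  /-- The boundary point sent to `0`. -/
  α : ℂ
  /-- The boundary point sent to `∞`. -/
  β : ℂ
  /-- The rotation constant. -/
  c : ℂ
  norm_α : ‖α‖ = 1
  norm_β : ‖β‖ = 1
  sq_mul : c ^ 2 * α = -β
  re_pos : 0 < c.re

lemma exists_axis {α β : ℂ} (hα : ‖α‖ = 1) (hβ : ‖β‖ = 1) (hne : α ≠ β) :
    ∃ A : Axis, A.α = α ∧ A.β = β := by
  have hα0 : α ≠ 0 := by rintro rfl; simp at hα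
  have hβ0 : β ≠ 0 := by rintro rfl; simp at hβ
  have hx : -β / α ≠ 0 := div_ne_zero (neg_ne_zero.2 hβ0) hα0
  have hsq : (Complex.exp (Complex.log (-β / α) / 2)) ^ 2 * α = -β := by
    rw [← Complex.exp_nat_mul, Nat.cast_ofNat, mul_div_cancel₀ _ two_ne_zero, Complex.exp_log hx,
      div_mul_cancel₀ _ hα0]
  refine ⟨⟨α, β, Complex.exp (Complex.log (-β / α) / 2), hα, hβ, hsq, ?_⟩, rfl, rfl⟩
  have him : (Complex.log (-β / α) / 2).im = (-β / α).arg / 2 := by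
    rw [Complex.div_ofNat_im, Complex.log_im]
  have hne' : (-β / α).arg ≠ Real.pi := by
    intro h
    have h1 := Complex.norm_mul_exp_arg_mul_I (-β / α)
    rw [h, Complex.exp_pi_mul_I, norm_div, norm_neg, hα, hβ, div_one, eq_div_iff hα0] at h1
    refine hne ?_
    push_cast at h1
    linear_combination -h1
  rw [Complex.exp_re, him]
  refine mul_pos (Real.exp_pos _) (Real.cos_pos_of_mem_Ioo ⟨?_, ?_⟩)
  · linarith [Complex.neg_pi_lt_arg (-β / α)]
  · linarith [lt_of_le_of_ne (Complex.arg_le_pi (-β / α)) hne']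

namespace Axis

variable (A : Axis)

/-- The coordinate `c (α - z) / (z - β)`, with values in the right half-plane on the disc. -/
def coord (z : ℂ) : ℂ := A.c * (A.α - z) / (z - A.β)

/-- The inverse of `coord`. -/
def point (x : ℂ) : ℂ := (A.c * A.α + A.β * x) / (A.c + x)

lemma norm_c : ‖A.c‖ = 1 := by
  have h : ‖A.c‖ ^ 2 = 1 := by
    have := congrArg norm A.sq_mul
    rwa [norm_mul, norm_pow, norm_neg, A.norm_α, A.norm_β, mul_one] at this
  exact (pow_eq_one_iff_of_nonneg (norm_nonneg _) two_ne_zero).1 h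

lemma α_ne_zero : A.α ≠ 0 := by
  intro h; simpa [h] using A.norm_α

lemma c_ne_zero : A.c ≠ 0 := by
  intro h; simpa [h] using A.norm_c

lemma α_ne_β : A.α ≠ A.β := by
  intro h
  have h1 : A.c ^ 2 = -1 := by
    have := A.sq_mul
    rw [← h, ← neg_one_mul] at this
    exact mul_right_cancel₀ A.α_ne_zero this
  have h2 : (A.c - Complex.I) * (A.c + Complex.I) = 0 := by
    ring_nf
    rw [h1, Complex.I_sq]; ring
  have hre := A.re_pos
  rcases mul_eq_zero.1 h2 with h3 | h3
  · rw [sub_eq_zero.1 h3] at hre; simp at hre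
  · rw [eq_neg_of_add_eq_zero_left h3] at hre; simp at hre

lemma norm_α_sub_β_pos : 0 < ‖A.α - A.β‖ := norm_pos_iff.2 (sub_ne_zero.2 A.α_ne_β)

lemma sub_β_ne_zero {z : ℂ} (hz : ‖z‖ < 1) : z - A.β ≠ 0 := by
  intro h
  rw [sub_eq_zero.1 h, A.norm_β] at hz
  exact lt_irrefl _ hz

lemma re_coord_mul {z : ℂ} (hz : z - A.β ≠ 0) :
    (A.coord z).re * ‖z - A.β‖ ^ 2 = A.c.re * (1 - ‖z‖ ^ 2) := by
  have hcc : A.c * (starRingEnd ℂ) A.c = 1 := by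
    rw [Complex.mul_conj, Complex.normSq_eq_norm_sq, A.norm_c]; simp
  have hbb : A.β * (starRingEnd ℂ) A.β = 1 := by
    rw [Complex.mul_conj, Complex.normSq_eq_norm_sq, A.norm_β]; simp
  have hca : A.c * A.α = -A.β * (starRingEnd ℂ) A.c := by
    calc A.c * A.α = A.c ^ 2 * A.α * (starRingEnd ℂ) A.c := by
          linear_combination (-A.c * A.α) * hcc
      _ = _ := by rw [A.sq_mul]
  have hzz : z * (starRingEnd ℂ) z = ((‖z‖ ^ 2 : ℝ) : ℂ) := by
    rw [Complex.mul_conj, Complex.normSq_eq_norm_sq]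
  have hdd : (z - A.β) * (starRingEnd ℂ) (z - A.β) = ((‖z - A.β‖ ^ 2 : ℝ) : ℂ) := by
    rw [Complex.mul_conj, Complex.normSq_eq_norm_sq]
  -- The terms linear in `z` combine to `w - conj w`, which has no real part.
  set w := A.c * z * (starRingEnd ℂ) A.β with hw
  have hwc : (starRingEnd ℂ) w = (starRingEnd ℂ) A.c * (starRingEnd ℂ) z * A.β := by
    simp [hw]
  have key : A.coord z * ((‖z - A.β‖ ^ 2 : ℝ) : ℂ) =
      (w - (starRingEnd ℂ) w) + (starRingEnd ℂ) A.c - A.c * ((‖z‖ ^ 2 : ℝ) : ℂ) := by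
    rw [← hdd, coord, div_mul_eq_mul_div, mul_comm (A.c * _), mul_assoc,
      mul_div_cancel_left₀ _ hz, hwc, ← hzz, map_sub, hw]
    linear_combination ((starRingEnd ℂ) z - (starRingEnd ℂ) A.β) * hca +
      (starRingEnd ℂ) A.c * hbb
  have := congrArg Complex.re key
  rw [Complex.re_mul_ofReal, Complex.sub_re, Complex.add_re, Complex.sub_re, Complex.conj_re,
    Complex.conj_re, Complex.re_mul_ofReal] at this
  linarith

lemma coord_re_pos {z : ℂ} (hz : ‖z‖ < 1) : 0 < (A.coord z).re := by
  have h0 := A.sub_β_ne_zero hz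
  have h := A.re_coord_mul h0
  have h1 : 0 < ‖z - A.β‖ ^ 2 := by have := norm_pos_iff.2 h0; positivity
  refine pos_of_mul_pos_left ?_ h1.le
  rw [h]
  refine mul_pos A.re_pos ?_
  nlinarith [norm_nonneg z]

lemma re_le_norm_c_add {x : ℂ} (hx : 0 < x.re) : A.c.re ≤ ‖A.c + x‖ := by
  refine le_trans ?_ (Complex.re_le_norm _)
  rw [Complex.add_re]; linarith

lemma c_add_ne_zero {x : ℂ} (hx : 0 < x.re) : A.c + x ≠ 0 :=
  norm_pos_iff.1 (A.re_pos.trans_le (A.re_le_norm_c_add hx))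

lemma point_sub_β {x : ℂ} (hx : 0 < x.re) :
    A.point x - A.β = A.c * (A.α - A.β) / (A.c + x) := by
  have := A.c_add_ne_zero hx
  rw [point]; field_simp; ring

lemma point_sub_β_ne_zero {x : ℂ} (hx : 0 < x.re) : A.point x - A.β ≠ 0 := by
  rw [A.point_sub_β hx]
  exact div_ne_zero (mul_ne_zero A.c_ne_zero (sub_ne_zero.2 A.α_ne_β)) (A.c_add_ne_zero hx)

lemma coord_point {x : ℂ} (hx : 0 < x.re) : A.coord (A.point x) = x := by
  have h1 := A.c_add_ne_zero hx
  rw [coord, div_eq_iff (A.point_sub_β_ne_zero hx), point]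
  field_simp
  ring

lemma point_coord {z : ℂ} (hz : ‖z‖ < 1) : A.point (A.coord z) = z := by
  have h1 := A.c_add_ne_zero (A.coord_re_pos hz)
  have h2 := A.sub_β_ne_zero hz
  rw [point, div_eq_iff h1, coord]
  field_simp
  ring

lemma norm_point_lt {x : ℂ} (hx : 0 < x.re) : ‖A.point x‖ < 1 := by
  have h0 := A.point_sub_β_ne_zero hx
  have h := A.re_coord_mul h0
  rw [A.coord_point hx] at h
  have h1 : 0 < ‖A.point x - A.β‖ ^ 2 := by have := norm_pos_iff.2 h0; positivity
  have h2 : 0 < A.c.re * (1 - ‖A.point x‖ ^ 2) := h ▸ mul_pos hx h1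
  have h3 := pos_of_mul_pos_right h2 A.re_pos.le
  nlinarith [norm_nonneg (A.point x)]

lemma differentiableOn_coord : DifferentiableOn ℂ A.coord (Metric.ball 0 1) := by
  refine DifferentiableOn.div (by fun_prop) (by fun_prop) fun z hz => ?_
  exact A.sub_β_ne_zero (by simpa using hz)

lemma differentiableOn_point : DifferentiableOn ℂ A.point {x | 0 < x.re} :=
  DifferentiableOn.div (by fun_prop) (by fun_prop) fun _ hx => A.c_add_ne_zero hx

lemma coord_zero : A.coord 0 = (starRingEnd ℂ) A.c := by
  have hcc : A.c * (starRingEnd ℂ) A.c = 1 := by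
    rw [Complex.mul_conj, Complex.normSq_eq_norm_sq, A.norm_c]; simp
  have hβ : 0 - A.β ≠ 0 := A.sub_β_ne_zero (by simp)
  rw [coord, div_eq_iff hβ, sub_zero]
  have := A.sq_mul
  linear_combination (-A.c * A.α) * hcc + (starRingEnd ℂ) A.c * this

lemma norm_coord_mul {z : ℂ} (hz : ‖z‖ < 1) : ‖A.coord z‖ * ‖z - A.β‖ = ‖A.α - z‖ := by
  have h := norm_pos_iff.2 (A.sub_β_ne_zero hz)
  rw [coord, norm_div, norm_mul, A.norm_c, one_mul, div_mul_cancel₀ _ h.ne']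

/-! ### The hyperbolic flow -/

lemma exp_mul_re_pos (t : ℝ) {x : ℂ} (hx : 0 < x.re) : 0 < ((Real.exp t : ℂ) * x).re := by
  rw [Complex.re_ofReal_mul]
  exact mul_pos (Real.exp_pos t) hx

/-- The one-parameter group of hyperbolic automorphisms fixing `α` and `β`; in the half-plane
coordinate it is the group of dilations `x ↦ e^t x`. -/
def flow (t : ℝ) (z : 𝔻) : 𝔻 :=
  Complex.UnitDisc.mk (A.point (Real.exp t * A.coord z))
    (A.norm_point_lt (exp_mul_re_pos t (A.coord_re_pos z.norm_lt_one)))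

lemma coord_flow (t : ℝ) (z : 𝔻) : A.coord (A.flow t z) = Real.exp t * A.coord z :=
  A.coord_point (exp_mul_re_pos t (A.coord_re_pos z.norm_lt_one))

lemma coord_injective {z w : 𝔻} (h : A.coord z = A.coord w) : z = w := by
  rw [← Complex.UnitDisc.coe_inj, ← A.point_coord z.norm_lt_one, h, A.point_coord w.norm_lt_one]

lemma flow_zero (z : 𝔻) : A.flow 0 z = z :=
  A.coord_injective (by rw [coord_flow, Real.exp_zero, Complex.ofReal_one, one_mul])

lemma flow_flow (s t : ℝ) (z : 𝔻) : A.flow s (A.flow t z) = A.flow (s + t) z :=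
  A.coord_injective (by
    rw [coord_flow, coord_flow, coord_flow, Real.exp_add, Complex.ofReal_mul, mul_assoc])

lemma isAnalyticOnDisc_flow (t : ℝ) : IsAnalyticOnDisc fun z => (A.flow t z : ℂ) := by
  refine isAnalyticOnDisc_coe (F := fun z => A.point (Real.exp t * A.coord z)) ?_
  refine DifferentiableOn.comp A.differentiableOn_point (A.differentiableOn_coord.const_mul _)
    fun z hz => ?_
  exact exp_mul_re_pos t (A.coord_re_pos (by simpa using hz))

lemma exp_mul_sq_le (t : ℝ) : (1 + Real.exp t) ^ 2 ≤ 4 * (Real.exp t * Real.exp |t|) := by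
  rcases le_total 0 t with h | h
  · rw [abs_of_nonneg h]
    nlinarith [Real.one_le_exp h]
  · rw [abs_of_nonpos h, ← Real.exp_add, add_neg_cancel, Real.exp_zero]
    nlinarith [Real.exp_le_one_iff.2 h, Real.exp_pos t]

/-- The Littlewood subordination constant of the flow grows like `e^{|t|}`. -/
lemma flow_const_le (t : ℝ) : (1 + ‖(A.flow t 0 : ℂ)‖) / (1 - ‖(A.flow t 0 : ℂ)‖) ≤
    16 / ‖A.α - A.β‖ ^ 2 * Real.exp |t| := by
  set z := ((A.flow t 0 : 𝔻) : ℂ) with hz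
  have hz1 : ‖z‖ < 1 := (A.flow t 0).norm_lt_one
  have hn := norm_nonneg z
  have hd := A.norm_α_sub_β_pos
  have hcz : A.coord z = Real.exp t * (starRingEnd ℂ) A.c := by
    rw [hz, coord_flow, Complex.UnitDisc.coe_zero, coord_zero]
  have h1 : 1 - ‖z‖ ^ 2 = Real.exp t * ‖z - A.β‖ ^ 2 := by
    have h := A.re_coord_mul (A.sub_β_ne_zero hz1)
    rw [hcz, Complex.re_ofReal_mul, Complex.conj_re] at h
    refine mul_left_cancel₀ A.re_pos.ne' ?_
    rw [← h]; ring
  have h2 : ‖A.α - z‖ = Real.exp t * ‖z - A.β‖ := by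
    rw [← A.norm_coord_mul hz1, hcz, norm_mul, Complex.norm_real, Complex.norm_conj, A.norm_c,
      mul_one, Real.norm_eq_abs, Real.abs_exp]
  have h3 : ‖A.α - A.β‖ ≤ (1 + Real.exp t) * ‖z - A.β‖ := by
    have := norm_add_le (A.α - z) (z - A.β)
    rw [sub_add_sub_cancel, h2] at this
    linarith
  have h4 : ‖A.α - A.β‖ ^ 2 ≤ 4 * Real.exp |t| * (1 - ‖z‖ ^ 2) := by
    calc ‖A.α - A.β‖ ^ 2 ≤ ((1 + Real.exp t) * ‖z - A.β‖) ^ 2 := by gcongr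
      _ = (1 + Real.exp t) ^ 2 * ‖z - A.β‖ ^ 2 := by ring
      _ ≤ 4 * (Real.exp t * Real.exp |t|) * ‖z - A.β‖ ^ 2 := by
        gcongr; exact exp_mul_sq_le t
      _ = _ := by rw [h1]; ring
  rw [div_le_iff₀ (by linarith), div_mul_eq_mul_div, div_mul_eq_mul_div,
    le_div_iff₀ (by positivity)]
  calc (1 + ‖z‖) * ‖A.α - A.β‖ ^ 2 ≤ (1 + ‖z‖) * (4 * Real.exp |t| * (1 - ‖z‖ ^ 2)) := by gcongr
    _ = (1 + ‖z‖) ^ 2 * (4 * Real.exp |t| * (1 - ‖z‖)) := by ring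
    _ ≤ 2 ^ 2 * (4 * Real.exp |t| * (1 - ‖z‖)) := by
      have : 0 ≤ 1 - ‖z‖ := by linarith
      gcongr
      linarith
    _ = _ := by ring

/-- The flow is uniformly continuous in time, uniformly on the disc. -/
lemma norm_flow_sub_flow_le (s t : ℝ) (z : 𝔻) : ‖(A.flow s z : ℂ) - A.flow t z‖ ≤
    2 * (1 + 1 / A.c.re) / A.c.re * |Real.exp (s - t) - 1| := by
  have hre := A.re_pos
  set y := A.coord (A.flow t z) with hy
  have hyre : 0 < y.re := A.coord_re_pos (A.flow t z).norm_lt_one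
  have hs : A.coord (A.flow s z) = Real.exp (s - t) * y := by
    rw [hy, coord_flow, coord_flow, ← mul_assoc, ← Complex.ofReal_mul, ← Real.exp_add,
      sub_add_cancel]
  set x := (Real.exp (s - t) : ℂ) * y with hx
  have hxre : 0 < x.re := exp_mul_re_pos _ hyre
  have h1 : (A.flow s z : ℂ) - A.flow t z =
      A.c * (A.α - A.β) * (y - x) / ((A.c + x) * (A.c + y)) := by
    rw [← A.point_coord (A.flow s z).norm_lt_one, hs, ← A.point_coord (A.flow t z).norm_lt_one,
      ← hy, point, point, div_sub_div _ _ (A.c_add_ne_zero hxre) (A.c_add_ne_zero hyre)]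
    congr 1; ring
  have h2 : ‖y - x‖ = |Real.exp (s - t) - 1| * ‖y‖ := by
    rw [show y - x = -(((Real.exp (s - t) - 1 : ℝ) : ℂ) * y) by push_cast; rw [hx]; push_cast; ring,
      norm_neg, norm_mul, Complex.norm_real, Real.norm_eq_abs]
  have hcx := A.re_le_norm_c_add hxre
  have hcy := A.re_le_norm_c_add hyre
  have hcy0 : 0 < ‖A.c + y‖ := hre.trans_le hcy
  have hab : ‖A.α - A.β‖ ≤ 2 := by
    have := norm_sub_le A.α A.β
    rw [A.norm_α, A.norm_β] at this; linarith
  have h3 : ‖y‖ / ‖A.c + y‖ ≤ 1 + 1 / A.c.re := by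
    have : ‖y‖ ≤ ‖A.c + y‖ + 1 := by
      have := norm_sub_le (A.c + y) A.c
      rwa [add_sub_cancel_left, A.norm_c] at this
    calc ‖y‖ / ‖A.c + y‖ ≤ (‖A.c + y‖ + 1) / ‖A.c + y‖ := by gcongr
      _ = 1 + 1 / ‖A.c + y‖ := by field_simp
      _ ≤ _ := by gcongr
  rw [h1, norm_div, norm_mul, norm_mul, norm_mul, A.norm_c, one_mul, h2]
  calc ‖A.α - A.β‖ * (|Real.exp (s - t) - 1| * ‖y‖) / (‖A.c + x‖ * ‖A.c + y‖) =
        ‖A.α - A.β‖ * (‖y‖ / ‖A.c + y‖) / ‖A.c + x‖ * |Real.exp (s - t) - 1| := by ring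
    _ ≤ _ := by gcongr

end Axis

namespace Axis

variable (A : Axis)

/-! ### Powers of the half-plane coordinate -/

/-- The logarithm of the half-plane coordinate; it maps the disc onto `{|Im| < π / 2}`. -/
def logCoord (z : ℂ) : ℂ := Complex.log (A.coord z)

lemma differentiableOn_logCoord : DifferentiableOn ℂ A.logCoord (Metric.ball 0 1) :=
  A.differentiableOn_coord.clog fun _ hz => Or.inl (A.coord_re_pos (by simpa using hz))

lemma abs_logCoord_im_le {z : ℂ} (hz : ‖z‖ < 1) : |(A.logCoord z).im| ≤ Real.pi / 2 := by
  rw [logCoord, Complex.log_im]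
  exact (Complex.abs_arg_lt_pi_div_two_iff.2 (Or.inl (A.coord_re_pos hz))).le

lemma logCoord_flow (t : ℝ) (z : 𝔻) : A.logCoord (A.flow t z) = t + A.logCoord z := by
  have h0 : A.coord z ≠ 0 := by
    intro h
    have := A.coord_re_pos z.norm_lt_one
    rw [h] at this; simp at this
  rw [logCoord, coord_flow, Complex.log_ofReal_mul (Real.exp_pos t) h0, Real.log_exp, logCoord]

lemma re_logCoord (z : ℂ) : (A.logCoord z).re = Real.log ‖A.coord z‖ := by
  rw [logCoord, Complex.log_re]

lemma logCoord_zero_re : (A.logCoord 0).re = 0 := by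
  rw [re_logCoord, coord_zero, Complex.norm_conj, A.norm_c, Real.log_one]

/-- The power `σ ^ s` of the half-plane coordinate `σ`. It is an eigenfunction of the composition
operators of the flow. -/
def powFun (s z : ℂ) : ℂ := Complex.exp (s * A.logCoord z)

lemma differentiableOn_powFun (s : ℂ) : DifferentiableOn ℂ (A.powFun s) (Metric.ball 0 1) :=
  (A.differentiableOn_logCoord.const_mul s).cexp

lemma powFun_flow (s : ℂ) (t : ℝ) (z : 𝔻) :
    A.powFun s (A.flow t z) = Complex.exp (s * t) * A.powFun s z := by
  rw [powFun, logCoord_flow, mul_add, Complex.exp_add, powFun]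

lemma norm_powFun_le (s : ℂ) {z : ℂ} (hz : ‖z‖ < 1) :
    ‖A.powFun s z‖ ≤ Real.exp (2 * |s.im|) * Real.exp (|s.re| * |(A.logCoord z).re|) := by
  rw [powFun, Complex.norm_exp, Complex.mul_re, ← Real.exp_add]
  refine Real.exp_le_exp.2 ?_
  have h1 := le_abs_self (s.re * (A.logCoord z).re)
  have h2 := neg_abs_le (s.im * (A.logCoord z).im)
  rw [abs_mul] at h1 h2
  have h3 : |s.im| * |(A.logCoord z).im| ≤ |s.im| * 2 :=
    mul_le_mul_of_nonneg_left ((A.abs_logCoord_im_le hz).trans (by linarith [Real.pi_le_four]))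
      (abs_nonneg _)
  linarith

lemma norm_powFun_ofReal (b : ℝ) (z : ℂ) :
    ‖A.powFun b z‖ = Real.exp (b * (A.logCoord z).re) := by
  rw [powFun, Complex.norm_exp, Complex.re_ofReal_mul]

/-- For `|b| < 1` the function `σ ^ b` takes values in a sector around the positive axis. -/
lemma norm_powFun_mul_cos_le {b : ℝ} (hb : |b| ≤ 1) {z : ℂ} (hz : ‖z‖ < 1) :
    ‖A.powFun b z‖ * Real.cos (|b| * (Real.pi / 2)) ≤ (A.powFun b z).re := by
  rw [norm_powFun_ofReal, powFun, Complex.exp_re, Complex.re_ofReal_mul, Complex.im_ofReal_mul]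
  refine mul_le_mul_of_nonneg_left ?_ (Real.exp_pos _).le
  rw [← Real.cos_abs (b * _), abs_mul]
  refine Real.cos_le_cos_of_nonneg_of_le_pi (by positivity) ?_
    (mul_le_mul_of_nonneg_left (A.abs_logCoord_im_le hz) (abs_nonneg b))
  nlinarith [Real.pi_pos]

/-- The key estimate for membership in `H^p`: if `0 ≤ b < 1 / p`, then analytic functions bounded
by `M e^{b |log |σ||}` have Hardy norm at most a constant times `M`. The functions
`σ ^ (± b p)` have values in a sector, so their moduli are controlled by their real parts, whose
means over circles are the values at the center. -/
lemma exists_hardyENorm_le {p : ℝ≥0∞} (hp : 1 ≤ p) (hp' : p ≠ ∞) {b : ℝ} (hb0 : 0 ≤ b)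
    (hb : b * p.toReal < 1) : ∃ K : ℝ, 0 ≤ K ∧ ∀ (M : ℝ) (g : 𝔻 → ℂ), 0 ≤ M → IsAnalyticOnDisc g →
      (∀ z : 𝔻, ‖g z‖ ≤ M * Real.exp (b * |(A.logCoord z).re|)) →
      hardyENorm p g ≤ ENNReal.ofReal (M * K) := by
  have hq : 0 < p.toReal := ENNReal.toReal_pos (by positivity) hp'
  set q := p.toReal with hqdef
  set d : ℝ := b * q with hd
  have hd0 : 0 ≤ d := by positivity
  have hcos : 0 < Real.cos (d * (Real.pi / 2)) := by
    refine Real.cos_pos_of_mem_Ioo ⟨?_, ?_⟩ <;> nlinarith [Real.pi_pos]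
  set κ := Real.cos (d * (Real.pi / 2)) with hκ
  refine ⟨(2 / κ) ^ (1 / q), by positivity, fun M g hM hg hgb => ?_⟩
  refine hardyENorm_le_of_integralMean_le fun r h0 h1 => ?_
  set h : ℂ → ℂ := fun z => A.powFun d z + A.powFun (-d : ℝ) z with hh
  have hhd : DifferentiableOn ℂ h (Metric.ball 0 1) :=
    (A.differentiableOn_powFun _).add (A.differentiableOn_powFun _)
  have hexp {z : ℂ} (hz : ‖z‖ < 1) :
      Real.exp (d * |(A.logCoord z).re|) * κ ≤ (h z).re := by
    have h2 := A.norm_powFun_mul_cos_le (b := d) (by rw [abs_of_nonneg hd0]; exact hb.le) hz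
    have h3 := A.norm_powFun_mul_cos_le (b := -d)
      (by rw [abs_neg, abs_of_nonneg hd0]; exact hb.le) hz
    rw [abs_neg] at h3
    rw [abs_of_nonneg hd0, norm_powFun_ofReal] at h2 h3
    rw [hh, Complex.add_re]
    refine le_trans ?_ (add_le_add h2 h3)
    rw [← add_mul]
    refine mul_le_mul_of_nonneg_right ?_ hcos.le
    rcases abs_choice (A.logCoord z).re with h | h <;> rw [h]
    · linarith [Real.exp_pos (-d * (A.logCoord z).re)]
    · rw [mul_neg, ← neg_mul]; linarith [Real.exp_pos (d * (A.logCoord z).re)]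
  have hcirc := norm_circleMap_lt_one h0.le h1
  have hhc : Continuous fun θ => h (circleMap 0 r θ) :=
    hhd.continuousOn.comp_continuous (continuous_circleMap 0 r) fun θ => by simpa using hcirc θ
  have hmean : ∫ θ, (h (circleMap 0 r θ)).re ∂angleMeasure ≤ 2 := by
    have hav := DiffContOnCl.circleAverage (f := h) (c := 0) (R := r)
      ((hhd.mono (Metric.closure_ball_subset_closedBall.trans
        (by rw [abs_of_pos h0]; exact Metric.closedBall_subset_ball h1))).diffContOnCl)
    rw [circleAverage_eq_integral_angleMeasure] at hav
    have hre := Complex.reCLM.integral_comp_comm (integrable_angleMeasure hhc)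
    simp only [Complex.reCLM_apply] at hre
    rw [hre, hav]
    refine (Complex.re_le_norm _).trans ((norm_add_le _ _).trans ?_)
    rw [norm_powFun_ofReal, norm_powFun_ofReal, logCoord_zero_re]
    norm_num
  have hbound (θ : ℝ) : ‖zeroExt g (circleMap 0 r θ)‖ₑ ^ q ≤
      ENNReal.ofReal (M ^ q / κ * (h (circleMap 0 r θ)).re) := by
    rw [← ofReal_norm, ENNReal.ofReal_rpow_of_nonneg (norm_nonneg _) hq.le]
    refine ENNReal.ofReal_le_ofReal ?_
    have hg1 : ‖zeroExt g (circleMap 0 r θ)‖ ≤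
        M * Real.exp (b * |(A.logCoord (circleMap 0 r θ)).re|) := by
      rw [zeroExt_apply _ (hcirc θ)]
      exact hgb _
    refine (Real.rpow_le_rpow (norm_nonneg _) hg1 hq.le).trans ?_
    rw [Real.mul_rpow hM (Real.exp_pos _).le, ← Real.exp_mul, div_mul_eq_mul_div, mul_div_assoc]
    refine mul_le_mul_of_nonneg_left ?_ (by positivity)
    rw [le_div_iff₀ hcos, mul_right_comm]
    exact hexp (hcirc θ)
  have hhnn (θ : ℝ) : 0 ≤ (h (circleMap 0 r θ)).re :=
    (mul_pos (Real.exp_pos _) hcos).le.trans (hexp (hcirc θ))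
  rw [integralMean, eLpNorm_eq_lintegral_rpow_enorm_toReal (by positivity) hp', ← hqdef]
  calc _ ≤ (∫⁻ θ, ENNReal.ofReal (M ^ q / κ * (h (circleMap 0 r θ)).re) ∂angleMeasure) ^ (1 / q) :=
        ENNReal.rpow_le_rpow (lintegral_mono hbound) (by positivity)
    _ = ENNReal.ofReal (∫ θ, M ^ q / κ * (h (circleMap 0 r θ)).re ∂angleMeasure) ^ (1 / q) := by
        rw [ofReal_integral_eq_lintegral_ofReal
          (integrable_angleMeasure (f := fun θ => M ^ q / κ * (h (circleMap 0 r θ)).re)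
            (continuous_const.mul (Complex.continuous_re.comp hhc)))
          (ae_of_all _ fun θ => mul_nonneg (by positivity) (hhnn θ))]
    _ ≤ ENNReal.ofReal (M ^ q * (2 / κ)) ^ (1 / q) := by
        refine ENNReal.rpow_le_rpow (ENNReal.ofReal_le_ofReal ?_) (by positivity)
        rw [integral_const_mul]
        calc _ ≤ M ^ q / κ * 2 := mul_le_mul_of_nonneg_left hmean (by positivity)
          _ = _ := by ring
    _ = _ := by
        rw [ENNReal.ofReal_rpow_of_nonneg (by positivity) (by positivity),
          Real.mul_rpow (by positivity) (by positivity), ← Real.rpow_mul hM,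
          mul_one_div_cancel hq.ne', Real.rpow_one]

variable {p : ℝ≥0∞} [hp : Fact (1 ≤ p)]

open HardySpace

lemma hardyENorm_powFun_lt_top (hp' : p ≠ ∞) {s : ℂ} (hs : |s.re| * p.toReal < 1) :
    hardyENorm p (fun z : 𝔻 => A.powFun s z) < ∞ := by
  obtain ⟨K, -, hK⟩ := A.exists_hardyENorm_le hp.out hp' (abs_nonneg s.re) hs
  exact (hK _ _ (Real.exp_pos _).le (isAnalyticOnDisc_coe (A.differentiableOn_powFun s))
    fun z => A.norm_powFun_le s z.norm_lt_one).trans_lt ENNReal.ofReal_lt_top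

open Classical in
/-- The function `σ ^ s` as an element of `H^p`, for `|Re s| < 1 / p`; outside of this strip the
value is set to `0`. -/
def powHardy (p : ℝ≥0∞) [Fact (1 ≤ p)] (s : ℂ) : HardySpace p :=
  if h : hardyENorm p (fun z : 𝔻 => A.powFun s z) < ∞ then
    ofFun _ (isAnalyticOnDisc_coe (A.differentiableOn_powFun s)) h
  else 0

lemma powHardy_apply (hp' : p ≠ ∞) {s : ℂ} (hs : |s.re| * p.toReal < 1) (z : 𝔻) :
    A.powHardy p s z = A.powFun s z := by
  rw [powHardy, dif_pos (A.hardyENorm_powFun_lt_top hp' hs), ofFun_apply]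

lemma norm_exp_sub_one_sub_le (h L : ℂ) {ε : ℝ} (hε : 0 < ε) (hh : ‖h‖ ≤ ε) :
    ‖Complex.exp (h * L) - 1 - h * L‖ ≤ ‖h‖ ^ 2 * (2 / ε ^ 2 * Real.exp (2 * ε * ‖L‖)) := by
  have h1 := Complex.norm_exp_sub_sum_le_norm_mul_exp (h * L) 2
  simp only [Finset.sum_range_succ, Finset.sum_range_zero, pow_zero, Nat.factorial_zero,
    Nat.cast_one, div_one, zero_add, pow_one, Nat.factorial_one, ← sub_sub] at h1
  refine h1.trans ?_
  have hL := norm_nonneg L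
  have h2 : (ε * ‖L‖) ^ 2 / 2 ≤ Real.exp (ε * ‖L‖) := by
    have := Real.quadratic_le_exp_of_nonneg (mul_nonneg hε.le hL)
    nlinarith [mul_nonneg hε.le hL]
  have h3 : ‖L‖ ^ 2 ≤ 2 / ε ^ 2 * Real.exp (ε * ‖L‖) := by
    rw [div_mul_eq_mul_div, le_div_iff₀ (by positivity)]
    nlinarith
  have h4 : Real.exp (‖h‖ * ‖L‖) ≤ Real.exp (ε * ‖L‖) :=
    Real.exp_le_exp.2 (mul_le_mul_of_nonneg_right hh hL)
  rw [norm_mul, mul_pow, mul_assoc]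
  refine mul_le_mul_of_nonneg_left ?_ (by positivity)
  calc _ ≤ 2 / ε ^ 2 * Real.exp (ε * ‖L‖) * Real.exp (ε * ‖L‖) := by gcongr
    _ = _ := by rw [mul_assoc, ← Real.exp_add]; ring_nf

/-- The map `s ↦ σ ^ s` is holomorphic into `H^p` on the strip `|Re s| < 1 / p`. -/
lemma differentiableAt_powHardy (hp' : p ≠ ∞) {s : ℂ} (hs : |s.re| * p.toReal < 1) :
    DifferentiableAt ℂ (A.powHardy p) s := by
  have hq : 0 < p.toReal := ENNReal.toReal_pos (by have := hp.out; positivity) hp'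
  -- `ε` leaves room for the factors `log σ` and `e^{h log σ}` inside the strip
  obtain ⟨ε, hε, hεb⟩ : ∃ ε : ℝ, 0 < ε ∧ (|s.re| + 2 * ε) * p.toReal < 1 := by
    refine ⟨(1 - |s.re| * p.toReal) / (4 * p.toReal), by
      have : 0 < 1 - |s.re| * p.toReal := by linarith
      positivity, ?_⟩
    rw [add_mul]
    have : 2 * ((1 - |s.re| * p.toReal) / (4 * p.toReal)) * p.toReal =
        (1 - |s.re| * p.toReal) / 2 := by
      field_simp; ring
    linarith
  obtain ⟨K, hK0, hK⟩ := A.exists_hardyENorm_le hp.out hp' (b := |s.re| + 2 * ε) (by positivity) hεb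
  have hLle {z : ℂ} (hz : ‖z‖ < 1) : ‖A.logCoord z‖ ≤ |(A.logCoord z).re| + 2 :=
    (Complex.norm_le_abs_re_add_abs_im _).trans (by
      linarith [A.abs_logCoord_im_le hz, Real.pi_le_four])
  -- any factor of size `e^{2 ε |log σ|}` is admissible
  have hfac {z : ℂ} (hz : ‖z‖ < 1) : Real.exp (2 * ε * ‖A.logCoord z‖) * ‖A.powFun s z‖ ≤
      Real.exp (4 * ε + 2 * |s.im|) *
        Real.exp ((|s.re| + 2 * ε) * |(A.logCoord z).re|) := by
    calc _ ≤ Real.exp (2 * ε * (|(A.logCoord z).re| + 2)) *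
          (Real.exp (2 * |s.im|) * Real.exp (|s.re| * |(A.logCoord z).re|)) := by
          gcongr
          · exact hLle hz
          · exact A.norm_powFun_le s hz
      _ = _ := by rw [← Real.exp_add, ← Real.exp_add, ← Real.exp_add]; ring_nf
  set g : 𝔻 → ℂ := fun z => A.logCoord z * A.powFun s z with hg
  have hga : IsAnalyticOnDisc g := isAnalyticOnDisc_coe
    (A.differentiableOn_logCoord.mul (A.differentiableOn_powFun s))
  have hgfin : hardyENorm p g < ∞ := by
    refine (hK (1 / (2 * ε) * Real.exp (4 * ε + 2 * |s.im|)) g (by positivity) hga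
      fun z => ?_).trans_lt ENNReal.ofReal_lt_top
    have h1 : ‖A.logCoord z‖ ≤ 1 / (2 * ε) * Real.exp (2 * ε * ‖A.logCoord z‖) := by
      rw [div_mul_eq_mul_div, one_mul, le_div_iff₀ (by positivity)]
      linarith [Real.add_one_le_exp (2 * ε * ‖A.logCoord z‖)]
    rw [hg, norm_mul, mul_assoc]
    calc _ ≤ 1 / (2 * ε) * Real.exp (2 * ε * ‖A.logCoord z‖) * ‖A.powFun s z‖ := by gcongr
      _ ≤ _ := by
        rw [mul_assoc]
        exact mul_le_mul_of_nonneg_left (hfac z.norm_lt_one) (by positivity)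
  have hderiv : HasDerivAt (A.powHardy p) (ofFun g hga hgfin) s := by
    rw [hasDerivAt_iff_isLittleO_nhds_zero]
    refine Asymptotics.IsBigO.trans_isLittleO (g := fun h : ℂ => h ^ 2) ?_
      (Asymptotics.isLittleO_pow_id one_lt_two)
    refine Asymptotics.IsBigO.of_bound (2 / ε ^ 2 * Real.exp (4 * ε + 2 * |s.im|) * K) ?_
    filter_upwards [Metric.closedBall_mem_nhds (0 : ℂ) hε] with h hh
    have hh' : ‖h‖ ≤ ε := by simpa using hh
    have hsh : |(s + h).re| * p.toReal < 1 := by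
      refine lt_of_le_of_lt (mul_le_mul_of_nonneg_right ?_ hq.le) hεb
      rw [Complex.add_re]
      linarith [abs_add_le s.re h.re, Complex.abs_re_le_norm h]
    rw [norm_pow]
    refine norm_le_of_hardyENorm_le (by positivity) ?_
    refine (hK (2 / ε ^ 2 * Real.exp (4 * ε + 2 * |s.im|) * ‖h‖ ^ 2) _ (by positivity)
      (HardySpace.isAnalytic _) fun z => ?_).trans_eq (by ring_nf)
    rw [HardySpace.sub_apply, HardySpace.sub_apply, HardySpace.smul_apply, ofFun_apply,
      A.powHardy_apply hp' hsh, A.powHardy_apply hp' hs]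
    have hfact : A.powFun (s + h) z - A.powFun s z - h * g z =
        (Complex.exp (h * A.logCoord z) - 1 - h * A.logCoord z) * A.powFun s z := by
      simp only [hg, powFun, add_mul, Complex.exp_add]
      ring
    rw [hfact, norm_mul]
    calc _ ≤ ‖h‖ ^ 2 * (2 / ε ^ 2 * Real.exp (2 * ε * ‖A.logCoord z‖)) * ‖A.powFun s z‖ := by
          gcongr; exact norm_exp_sub_one_sub_le _ _ hε hh'
      _ = ‖h‖ ^ 2 * (2 / ε ^ 2) * (Real.exp (2 * ε * ‖A.logCoord z‖) * ‖A.powFun s z‖) := by ring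
      _ ≤ ‖h‖ ^ 2 * (2 / ε ^ 2) * (Real.exp (4 * ε + 2 * |s.im|) *
            Real.exp ((|s.re| + 2 * ε) * |(A.logCoord z).re|)) :=
          mul_le_mul_of_nonneg_left (hfac z.norm_lt_one) (by positivity)
      _ = _ := by ring
  exact hderiv.differentiableAt

/-! ### The composition operators of the flow -/

/-- The composition operator of the hyperbolic automorphism `flow t`. -/
def flowOp (hp' : p ≠ ∞) (t : ℝ) : HardySpace p →L[ℂ] HardySpace p :=
  compCLM hp' (A.flow t) (A.isAnalyticOnDisc_flow t)

@[simp] lemma flowOp_apply (hp' : p ≠ ∞) (t : ℝ) (f : HardySpace p) (z : 𝔻) :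
    A.flowOp hp' t f z = f (A.flow t z) := rfl

lemma flowOp_powHardy (hp' : p ≠ ∞) (t : ℝ) {s : ℂ} (hs : |s.re| * p.toReal < 1) :
    A.flowOp hp' t (A.powHardy p s) = Complex.exp (s * t) • A.powHardy p s :=
  ext_apply fun z => by
    rw [flowOp_apply, HardySpace.smul_apply, A.powHardy_apply hp' hs, A.powHardy_apply hp' hs,
      powFun_flow]

lemma powHardy_zero_ne_zero (hp' : p ≠ ∞) : A.powHardy p 0 ≠ 0 := by
  intro h
  have h1 := A.powHardy_apply hp' (s := 0) (by simp) 0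
  rw [h, HardySpace.zero_apply, powFun, zero_mul, Complex.exp_zero] at h1
  exact zero_ne_one h1

/-- The eigenvectors `σ ^ s` depend holomorphically on the eigenvalue `e^{s t}`. -/
lemma not_hasSVEP_flowOp (hp' : p ≠ ∞) {t : ℝ} (ht : t ≠ 0) :
    ¬ HasSVEP (A.flowOp (p := p) hp' t) := by
  intro hS
  have := HardySpace.completeSpace (p := p) hp'
  set U : Set ℂ := Complex.slitPlane ∩
    (fun z => |(Complex.log z / t).re| * p.toReal) ⁻¹' Set.Iio 1 with hU
  have hlog : ContinuousOn Complex.log Complex.slitPlane := fun z hz =>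
    (continuousAt_clog hz).continuousWithinAt
  have hUo : IsOpen U := by
    refine ContinuousOn.isOpen_inter_preimage ?_ Complex.isOpen_slitPlane isOpen_Iio
    exact ((Complex.continuous_re.comp_continuousOn (hlog.div_const _)).abs).mul
      continuousOn_const
  have hd : DifferentiableOn ℂ (fun z => A.powHardy p (Complex.log z / t)) U := by
    intro z hz
    refine DifferentiableAt.differentiableWithinAt ?_
    refine DifferentiableAt.comp (g := A.powHardy p) (f := fun z => Complex.log z / t) z
      (A.differentiableAt_powHardy hp' hz.2) ?_
    exact (Complex.differentiableAt_log hz.1).div_const _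
  have h := hS U (fun z => A.powHardy p (Complex.log z / t)) hUo (hd.analyticOnNhd hUo)
    (fun z hz => ?_) 1 ⟨Complex.one_mem_slitPlane, by simp⟩
  · rw [Complex.log_one, zero_div] at h
    exact A.powHardy_zero_ne_zero hp' h
  · have htc : (t : ℂ) ≠ 0 := Complex.ofReal_ne_zero.2 ht
    rw [A.flowOp_powHardy hp' t hz.2, div_mul_cancel₀ _ htc,
      Complex.exp_log (Complex.slitPlane_ne_zero hz.1), sub_self]

end Axis

namespace Axis

variable (A : Axis) {p : ℝ≥0∞} [hp : Fact (1 ≤ p)]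

open HardySpace

/-! ### Completeness of the family of eigenfunctions -/

lemma norm_sub_β_le {z : ℂ} (hz : ‖z‖ < 1) : ‖z - A.β‖ ≤ 2 := by
  have := norm_sub_le z A.β
  rw [A.norm_β] at this; linarith

/-- Near `β` the distance to `β` is controlled by every power `σ ^ (-δ)`, `0 ≤ δ ≤ 1`. -/
lemma norm_sub_β_le_exp {δ : ℝ} (h0 : 0 ≤ δ) (h1 : δ ≤ 1) {z : ℂ} (hz : ‖z‖ < 1) :
    ‖z - A.β‖ ≤ 2 * Real.exp (-δ * (A.logCoord z).re) := by
  rcases le_total (A.logCoord z).re 0 with h | h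
  · have : 1 ≤ Real.exp (-δ * (A.logCoord z).re) := Real.one_le_exp (by nlinarith)
    linarith [A.norm_sub_β_le hz]
  · have hc : 0 < ‖A.coord z‖ := norm_pos_iff.2 fun hc => by
      have := A.coord_re_pos hz
      rw [hc] at this; simp at this
    have h2 : ‖z - A.β‖ = ‖A.α - z‖ * Real.exp (-(A.logCoord z).re) := by
      rw [← A.norm_coord_mul hz, re_logCoord, Real.exp_neg, Real.exp_log hc, mul_right_comm,
        mul_inv_cancel₀ hc.ne', one_mul]
    have h3 : ‖A.α - z‖ ≤ 2 := by
      have := norm_sub_le A.α z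
      rw [A.norm_α] at this; linarith
    rw [h2]
    gcongr
    nlinarith

/-- The base point of the axis, where the half-plane coordinate is `1`. -/
def base : 𝔻 := Complex.UnitDisc.mk (A.point 1) (A.norm_point_lt (by simp))

lemma coord_base : A.coord A.base = 1 := A.coord_point (by simp)

lemma powFun_flow_base (s : ℂ) (t : ℝ) : A.powFun s (A.flow t A.base) = Complex.exp (s * t) := by
  rw [powFun_flow, powFun, logCoord, coord_base, Complex.log_one, mul_zero, Complex.exp_zero,
    mul_one]

lemma continuous_flow_apply (z : 𝔻) : Continuous fun t => (A.flow t z : ℂ) := by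
  rw [continuous_iff_continuousAt]
  intro t
  refine tendsto_iff_norm_sub_tendsto_zero.2 (squeeze_zero (fun _ => norm_nonneg _)
    (fun s => A.norm_flow_sub_flow_le s t z) ?_)
  have : Continuous fun s : ℝ => 2 * (1 + 1 / A.c.re) / A.c.re * |Real.exp (s - t) - 1| := by
    fun_prop
  simpa using this.tendsto t

/-- An analytic function that is an eigenfunction of the whole flow, `g ∘ flow t = e^{s t} g`, is a
multiple of `σ ^ s`: this is clear on the orbit of the base point, which accumulates in the disc. -/
lemma eq_powFun_of_flow_eigen {g : 𝔻 → ℂ} (hg : IsAnalyticOnDisc g) {s : ℂ}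
    (h : ∀ (t : ℝ) (z : 𝔻), g (A.flow t z) = Complex.exp (s * t) * g z) (z : 𝔻) :
    g z = g A.base * A.powFun s z := by
  have h1 : AnalyticOnNhd ℂ (zeroExt g) (Metric.ball 0 1) :=
    DifferentiableOn.analyticOnNhd hg Metric.isOpen_ball
  have h2 : AnalyticOnNhd ℂ (fun z => g A.base * A.powFun s z) (Metric.ball 0 1) :=
    ((A.differentiableOn_powFun s).const_mul _).analyticOnNhd Metric.isOpen_ball
  have hfreq : ∃ᶠ w in 𝓝[≠] (A.base : ℂ), zeroExt g w = g A.base * A.powFun s w := by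
    have htend : Tendsto (fun t => (A.flow t A.base : ℂ)) (𝓝[≠] 0) (𝓝[≠] (A.base : ℂ)) := by
      refine tendsto_nhdsWithin_iff.2 ⟨?_, ?_⟩
      · have := (A.continuous_flow_apply A.base).tendsto 0
        rw [flow_zero] at this
        exact this.mono_left nhdsWithin_le_nhds
      · filter_upwards [self_mem_nhdsWithin] with t ht heq
        have h3 := congrArg A.coord heq
        rw [coord_flow, coord_base, mul_one] at h3
        exact ht (Real.exp_eq_one_iff t |>.1 (by exact_mod_cast h3))
    refine htend.frequently (Eventually.frequently (Eventually.of_forall fun t => ?_))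
    rw [zeroExt_coe, h, powFun_flow_base, mul_comm]
  have := h1.eqOn_of_preconnected_of_frequently_eq h2
    (convex_ball (0 : ℂ) 1).isPreconnected (z₀ := (A.base : ℂ))
    (by simpa using A.base.norm_lt_one) hfreq (x := (z : ℂ)) (by simpa using z.norm_lt_one)
  simpa using this

/-- A functional annihilating all `σ ^ s` annihilates the functions `f` that vanish at `β` and are
Lipschitz. For suitable `ε > 0` the function `t ↦ e^{ε t} ℓ (f ∘ flow t)` is integrable, and its
Fourier transform is `ℓ` of an eigenvector of the flow, hence a multiple of some `ℓ (σ ^ s) = 0`. -/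
lemma apply_eq_zero_of_lipschitz (hp' : p ≠ ∞) {ℓ : StrongDual ℂ (HardySpace p)}
    (hℓ : ∀ s : ℂ, |s.re| * p.toReal < 1 → ℓ (A.powHardy p s) = 0) {f : HardySpace p} {B : ℝ}
    (hB : 0 ≤ B) (hLip : ∀ z w : 𝔻, ‖f z - f w‖ ≤ B * ‖(z : ℂ) - w‖)
    (hβ : ∀ z : 𝔻, ‖f z‖ ≤ B * ‖(z : ℂ) - A.β‖) : ℓ f = 0 := by
  have := HardySpace.completeSpace (p := p) hp'
  have hq : 1 ≤ p.toReal := by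
    rw [← ENNReal.toReal_one]
    exact ENNReal.toReal_mono hp' hp.out
  have hq0 : 0 < p.toReal := by linarith
  set u : ℝ → HardySpace p := fun t => A.flowOp hp' t f with hu
  have huc : Continuous u := by
    rw [continuous_iff_continuousAt]
    intro t
    refine tendsto_iff_norm_sub_tendsto_zero.2 (squeeze_zero (fun _ => norm_nonneg _)
      (g := fun s => B * (2 * (1 + 1 / A.c.re) / A.c.re * |Real.exp (s - t) - 1|))
      (fun s => norm_le_of_norm_apply_le ?_ fun z => ?_) ?_)
    · have := A.re_pos; positivity
    · exact (hLip _ _).trans (mul_le_mul_of_nonneg_left (A.norm_flow_sub_flow_le s t z) hB)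
    · have : Continuous fun s : ℝ =>
          B * (2 * (1 + 1 / A.c.re) / A.c.re * |Real.exp (s - t) - 1|) := by fun_prop
      simpa using this.tendsto t
  -- the decay rate `δ = 0` is used for `t ≤ 0` and `δ = 2 ε` for `t > 0`
  have hun (δ : ℝ) (h0 : 0 ≤ δ) (h1 : δ ≤ 1) (h2 : δ * p.toReal < 1) (t : ℝ) :
      ‖u t‖ ≤ 2 * B * Real.exp (-δ * t) * ‖A.powHardy p (-δ : ℝ)‖ := by
    refine norm_le_mul_norm (by positivity) fun z => ?_
    rw [A.powHardy_apply hp' (by simpa [abs_of_nonneg h0] using h2), norm_powFun_ofReal]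
    refine (hβ (A.flow t z)).trans ?_
    have h3 := A.norm_sub_β_le_exp h0 h1 (A.flow t z).norm_lt_one
    rw [logCoord_flow, Complex.add_re, Complex.ofReal_re, mul_add, Real.exp_add] at h3
    calc _ ≤ B * _ := mul_le_mul_of_nonneg_left h3 hB
      _ = _ := by ring
  set ε : ℝ := 1 / (4 * p.toReal) with hε
  have hε0 : 0 < ε := by positivity
  have hεq : 2 * ε * p.toReal < 1 := by
    rw [hε]; field_simp; norm_num
  have hε1 : 2 * ε ≤ 1 := by nlinarith
  set s : ℝ → ℂ := fun y => -ε + 2 * Real.pi * y * Complex.I with hs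
  have hsre (y : ℝ) : (s y).re = -ε := by simp [hs]
  set G : ℝ → ℝ → HardySpace p := fun y t => Complex.exp (-s y * t) • u t with hG
  have hGc (y : ℝ) : Continuous (G y) := by
    have : Continuous fun t : ℝ => Complex.exp (-s y * t) := by fun_prop
    exact this.smul huc
  have hGn (y t : ℝ) : ‖G y t‖ = Real.exp (ε * t) * ‖u t‖ := by
    rw [hG, norm_smul, Complex.norm_exp, Complex.re_mul_ofReal, Complex.neg_re, hsre, neg_neg]
  have hGi (y : ℝ) : Integrable (G y) := by
    rw [← integrableOn_univ, ← Set.Iic_union_Ioi (a := (0 : ℝ))]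
    refine IntegrableOn.union ?_ ?_
    · refine Integrable.mono' ((integrableOn_exp_mul_Iic hε0 0).const_mul
        (2 * B * ‖A.powHardy p (-(0 : ℝ) : ℝ)‖)) (hGc y).aestronglyMeasurable
        (ae_of_all _ fun t => ?_)
      rw [hGn]
      have := hun 0 le_rfl zero_le_one (by simp) t
      rw [neg_zero, zero_mul, Real.exp_zero, mul_one] at this
      calc _ ≤ Real.exp (ε * t) * _ := mul_le_mul_of_nonneg_left this (Real.exp_pos _).le
        _ = _ := by rw [neg_zero]; ring
    · refine Integrable.mono' ((integrableOn_exp_mul_Ioi (neg_neg_iff_pos.2 hε0) 0).const_mul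
        (2 * B * ‖A.powHardy p (-(2 * ε) : ℝ)‖)) (hGc y).aestronglyMeasurable
        (ae_of_all _ fun t => ?_)
      rw [hGn]
      have := hun (2 * ε) (by positivity) hε1 hεq t
      calc _ ≤ Real.exp (ε * t) * _ := mul_le_mul_of_nonneg_left this (Real.exp_pos _).le
        _ = 2 * B * ‖A.powHardy p (-(2 * ε) : ℝ)‖ *
            (Real.exp (ε * t) * Real.exp (-(2 * ε) * t)) := by ring
        _ = _ := by rw [← Real.exp_add]; ring_nf
  have hsq (y : ℝ) : |(s y).re| * p.toReal < 1 := by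
    rw [hsre, abs_neg, abs_of_pos hε0]; nlinarith
  have hval (y : ℝ) (z : 𝔻) :
      (∫ t, G y t) z = ∫ t : ℝ, Complex.exp (-s y * t) * f (A.flow t z) := by
    rw [← evalCLM_apply hp', ← (evalCLM hp' z).integral_comp_comm (hGi y)]
    rfl
  have heig (y : ℝ) : ∃ a : ℂ, ∫ t, G y t = a • A.powHardy p (s y) := by
    refine ⟨(∫ t, G y t) A.base, ext_apply fun z => ?_⟩
    rw [HardySpace.smul_apply, A.powHardy_apply hp' (hsq y)]
    refine A.eq_powFun_of_flow_eigen (HardySpace.isAnalytic _) (fun τ w => ?_) z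
    rw [hval, hval, ← integral_const_mul, ← integral_add_right_eq_self
      (fun t : ℝ => Complex.exp (s y * τ) * (Complex.exp (-s y * t) * f (A.flow t w))) τ]
    refine integral_congr_ae (ae_of_all _ fun t => ?_)
    simp only [flow_flow, ← mul_assoc, ← Complex.exp_add]
    congr 2
    push_cast; ring
  have hzero (y : ℝ) : ∫ t, ℓ (G y t) = 0 := by
    obtain ⟨a, ha⟩ := heig y
    rw [ℓ.integral_comp_comm (hGi y), ha, map_smul, hℓ _ (hsq y), smul_zero]
  set v : ℝ → ℂ := fun t => ℓ (G 0 t) with hv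
  have hvc : Continuous v := ℓ.continuous.comp (hGc 0)
  have hvi : Integrable v := ℓ.integrable_comp (hGi 0)
  have hF : FourierTransform.fourier v = 0 := by
    funext y
    rw [Real.fourier_real_eq_integral_exp_smul, Pi.zero_apply, ← hzero y]
    refine integral_congr_ae (ae_of_all _ fun t => ?_)
    simp only [hv, hG, map_smul, smul_smul, ← Complex.exp_add]
    congr 2
    simp only [hs]
    push_cast
    ring
  have hinv := hvc.fourierInv_fourier_eq hvi (by rw [hF]; exact integrable_zero _ _ _)
  rw [hF] at hinv
  have hv0 : v 0 = 0 := by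
    rw [← hinv, Real.fourierInv_eq]
    simp
  have hu0 : u 0 = f := ext_apply fun z => by rw [hu, flowOp_apply, flow_zero]
  simpa [hv, hG, hu0] using hv0

/-- The powers `σ ^ s`, `|Re s| < 1 / p`, span a dense subspace of `H^p` for `1 < p < ∞`. -/
lemma eq_zero_of_apply_powHardy (hp1 : 1 < p) (hp' : p ≠ ∞) {ℓ : StrongDual ℂ (HardySpace p)}
    (hℓ : ∀ s : ℂ, |s.re| * p.toReal < 1 → ℓ (A.powHardy p s) = 0) : ℓ = 0 := by
  have hq0 : 0 < p.toReal := ENNReal.toReal_pos (by positivity) hp'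
  have hdil (f : HardySpace p) {r : ℝ} (h0 : 0 < r) (h1 : r < 1) (g : HardySpace p)
      (hg : ∀ z : 𝔻, g z = dilate f r z) : ℓ g = 0 := by
    have hsub : Metric.closedBall (0 : ℂ) r ⊆ Metric.ball 0 1 := Metric.closedBall_subset_ball h1
    have hfd : DifferentiableOn ℂ (zeroExt f) (Metric.ball 0 1) := f.isAnalytic
    obtain ⟨B, hB⟩ := (isCompact_closedBall (0 : ℂ) r).exists_bound_of_continuousOn
      ((hfd.deriv Metric.isOpen_ball).continuousOn.mono hsub)
    have hB0 : 0 ≤ B := (norm_nonneg _).trans (hB 0 (by simpa using h0.le))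
    have hLip {x y : ℂ} (hx : ‖x‖ ≤ 1) (hy : ‖y‖ ≤ 1) :
        ‖zeroExt f (r * x) - zeroExt f (r * y)‖ ≤ B * ‖x - y‖ := by
      have hmem {w : ℂ} (hw : ‖w‖ ≤ 1) : (r : ℂ) * w ∈ Metric.closedBall (0 : ℂ) r := by
        rw [mem_closedBall_zero_iff, norm_mul, Complex.norm_real, Real.norm_eq_abs, abs_of_pos h0]
        nlinarith
      refine ((convex_closedBall (0 : ℂ) r).norm_image_sub_le_of_norm_deriv_le
        (fun w hw => hfd.differentiableAt (Metric.isOpen_ball.mem_nhds (hsub hw))) hB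
        (hmem hy) (hmem hx)).trans ?_
      rw [← mul_sub, norm_mul, Complex.norm_real, Real.norm_eq_abs, abs_of_pos h0]
      nlinarith [mul_nonneg hB0 (norm_nonneg (x - y))]
    set κ := zeroExt f (r * A.β) with hκ
    have hone (z : 𝔻) : A.powHardy p 0 z = 1 := by
      rw [A.powHardy_apply hp' (by simp), powFun, zero_mul, Complex.exp_zero]
    have hgκ (z : 𝔻) : (g - κ • A.powHardy p 0) z = zeroExt f (r * z) - κ := by
      rw [HardySpace.sub_apply, HardySpace.smul_apply, hone, hg, mul_one, dilate]
    have h2 := A.apply_eq_zero_of_lipschitz hp' hℓ (f := g - κ • A.powHardy p 0) hB0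
      (fun z w => by
        rw [hgκ, hgκ, sub_sub_sub_cancel_right]
        exact hLip z.norm_lt_one.le w.norm_lt_one.le)
      (fun z => by
        rw [hgκ]
        exact hLip z.norm_lt_one.le A.norm_β.le)
    rw [map_sub, map_smul, hℓ 0 (by simp), smul_zero, sub_zero] at h2
    exact h2
  ext f
  refine norm_le_zero_iff.1 (le_of_forall_pos_le_add fun ε hε => ?_)
  set η : ℝ := (ε / (‖ℓ‖ + 1)) ^ p.toReal with hη
  have hη' : η ^ (1 / p.toReal) = ε / (‖ℓ‖ + 1) := by
    rw [hη, ← Real.rpow_mul (by positivity), mul_one_div_cancel hq0.ne', Real.rpow_one]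
  obtain ⟨r, h0, h1, hr⟩ := exists_hardyENorm_sub_dilate_le hp1 hp' f.isAnalytic
    f.hardyENorm_lt_top (η := η) (by positivity)
  have hda := isAnalyticOnDisc_dilate f.isAnalytic h0.le h1
  have hsuba : IsAnalyticOnDisc fun z => f z - dilate f r z := by
    have : (fun z => f z - dilate f r z) = (f : 𝔻 → ℂ) + (-1 : ℂ) • dilate f r := by
      funext z; simp [sub_eq_add_neg]
    rw [this, IsAnalyticOnDisc, zeroExt_add, zeroExt_smul]
    exact f.isAnalytic.add (hda.const_smul _)
  set d : HardySpace p := ofFun _ hsuba (hr.trans_lt ENNReal.ofReal_lt_top)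
  have hd : ‖d‖ ≤ ε / (‖ℓ‖ + 1) := by
    rw [← hη']
    exact norm_le_of_hardyENorm_le (by positivity) hr
  have hfd : ℓ f = ℓ d := by
    have := hdil f h0 h1 (f - d) fun z => by
      rw [HardySpace.sub_apply, ofFun_apply, sub_sub_cancel]
    rwa [map_sub, sub_eq_zero] at this
  rw [hfd, zero_add]
  calc ‖ℓ d‖ ≤ ‖ℓ‖ * ‖d‖ := ℓ.le_opNorm d
    _ ≤ (‖ℓ‖ + 1) * (ε / (‖ℓ‖ + 1)) := by gcongr; linarith
    _ = ε := by field_simp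

end Axis

/-! ### Local spectra of the adjoint -/

lemma localSpectrum_subset_spectrum {X : Type*} [NormedAddCommGroup X] [NormedSpace ℂ X]
    [CompleteSpace X] (T : X →L[ℂ] X) (x : X) : localSpectrum T x ⊆ spectrum ℂ T := by
  intro z hz
  by_contra hzT
  refine hz (Set.mem_sUnion.2 ⟨resolventSet ℂ T, ⟨spectrum.isOpen_resolventSet T,
    fun w => -(resolvent T w x), ?_, fun w hw => ?_⟩, by simpa [spectrum] using hzT⟩)
  · refine DifferentiableOn.analyticOnNhd (fun w hw => ?_) (spectrum.isOpen_resolventSet T)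
    have h := (spectrum.hasDerivAt_resolvent_const_left hw).differentiableAt
    exact ((h.clm_apply (differentiableAt_const x)).neg).differentiableWithinAt
  · have h : (algebraMap ℂ (X →L[ℂ] X) w - T) * resolvent T w = 1 := Ring.mul_inverse_cancel _ hw
    have h' := congrArg (fun S : X →L[ℂ] X => S x) h
    simp only [mul_apply_eq_comp, _root_.sub_apply,
      Algebra.algebraMap_eq_smul_one, _root_.smul_apply,
      one_apply_eq_self] at h'
    rw [map_neg, smul_neg, sub_neg_eq_add, neg_add_eq_sub, h']

lemma norm_le_of_mem_spectrum_of_norm_pow_le {X : Type*} [NormedAddCommGroup X] [NormedSpace ℂ X]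
    [CompleteSpace X] {T : X →L[ℂ] X} {M ρ : ℝ} (hρ : 0 < ρ) (hT : ∀ n : ℕ, ‖T ^ n‖ ≤ M * ρ ^ n)
    {z : ℂ} (hz : z ∈ spectrum ℂ T) : ‖z‖ ≤ ρ := by
  by_contra! hlt
  obtain ⟨n, hn⟩ := pow_unbounded_of_one_lt M ((one_lt_div hρ).2 hlt)
  have h1 := spectrum.norm_le_norm_mul_of_mem (spectrum.pow_mem_pow T n hz)
  have h2 : ‖z‖ ^ n ≤ M * ρ ^ n := by
    rw [← norm_pow]
    refine h1.trans ((mul_le_of_le_one_right (norm_nonneg _) ?_).trans (hT n))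
    exact ContinuousLinearMap.norm_id_le
  rw [div_pow, lt_div_iff₀ (by positivity)] at hn
  linarith

/-- The spectra of a group of operators `S t` with `‖S t‖ ≤ M e^{a |t|}` lie in the annuli
`e^{-a |t|} ≤ |z| ≤ e^{a |t|}`. -/
lemma mem_annulus_of_mem_spectrum {X : Type*} [NormedAddCommGroup X] [NormedSpace ℂ X]
    [CompleteSpace X] {S : ℝ → X →L[ℂ] X} (hzero : ∀ x, S 0 x = x)
    (hadd : ∀ s t x, S s (S t x) = S (s + t) x) {M a : ℝ}
    (hM : ∀ t, ‖S t‖ ≤ M * Real.exp (a * |t|)) {t : ℝ} {z : ℂ} (hz : z ∈ spectrum ℂ (S t)) :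
    z ≠ 0 ∧ |Real.log ‖z‖| ≤ a * |t| := by
  have hmul (s t : ℝ) : S s * S t = S (s + t) := ContinuousLinearMap.ext fun x => hadd s t x
  have hone : S 0 = 1 := ContinuousLinearMap.ext hzero
  have hpow (s : ℝ) (n : ℕ) : S s ^ n = S (n * s) := by
    induction n with
    | zero => rw [pow_zero, Nat.cast_zero, zero_mul, hone]
    | succ n ih => rw [pow_succ, ih, hmul]; push_cast; ring_nf
  have hnorm (s : ℝ) (n : ℕ) : ‖S s ^ n‖ ≤ M * Real.exp (a * |s|) ^ n := by
    rw [hpow]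
    refine (hM _).trans_eq ?_
    rw [← Real.exp_nat_mul, abs_mul, Nat.abs_cast]
    ring_nf
  set T : (X →L[ℂ] X)ˣ := ⟨S t, S (-t), by rw [hmul, add_neg_cancel, hone],
    by rw [hmul, neg_add_cancel, hone]⟩
  have hz' : z ∈ spectrum ℂ (T : X →L[ℂ] X) := hz
  have hz0 : z ≠ 0 := spectrum.ne_zero_of_mem_of_unit hz'
  have h1 : ‖z‖ ≤ Real.exp (a * |t|) :=
    norm_le_of_mem_spectrum_of_norm_pow_le (Real.exp_pos _) (hnorm t) hz
  have h2 : ‖z⁻¹‖ ≤ Real.exp (a * |t|) := by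
    have h3 : z⁻¹ ∈ spectrum ℂ (S (-t)) :=
      (spectrum.inv_mem_iff (r := Units.mk0 z hz0) (a := T)).1 hz'
    have h4 := norm_le_of_mem_spectrum_of_norm_pow_le (Real.exp_pos _) (hnorm (-t)) h3
    rwa [abs_neg] at h4
  have hpos : 0 < ‖z‖ := norm_pos_iff.2 hz0
  refine ⟨hz0, abs_le.2 ⟨?_, (Real.log_le_iff_le_exp hpos).2 h1⟩⟩
  rw [norm_inv] at h2
  have := (Real.log_le_iff_le_exp (inv_pos.2 hpos)).2 h2
  rw [Real.log_inv] at this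
  linarith

namespace Axis

variable (A : Axis) {p : ℝ≥0∞} [hp : Fact (1 ≤ p)]

open HardySpace

lemma adjointOp_flowOp_apply (hp' : p ≠ ∞) (t : ℝ) (ℓ : StrongDual ℂ (HardySpace p))
    (f : HardySpace p) : adjointOp (A.flowOp hp' t) ℓ f = ℓ (A.flowOp hp' t f) := rfl

lemma flowOp_flowOp (hp' : p ≠ ∞) (s t : ℝ) (f : HardySpace p) :
    A.flowOp hp' t (A.flowOp hp' s f) = A.flowOp hp' (s + t) f :=
  ext_apply fun z => by rw [flowOp_apply, flowOp_apply, flowOp_apply, flow_flow]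

lemma flowOp_zero (hp' : p ≠ ∞) (f : HardySpace p) : A.flowOp hp' 0 f = f :=
  ext_apply fun z => by rw [flowOp_apply, flow_zero]

lemma norm_adjointOp_flowOp_le (hp' : p ≠ ∞) (t : ℝ) : ‖adjointOp (A.flowOp (p := p) hp' t)‖ ≤
    (16 / ‖A.α - A.β‖ ^ 2) ^ (1 / p.toReal) * Real.exp (1 / p.toReal * |t|) := by
  have h1 : ‖A.flowOp (p := p) hp' t‖ ≤
      (16 / ‖A.α - A.β‖ ^ 2) ^ (1 / p.toReal) * Real.exp (1 / p.toReal * |t|) := by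
    refine (norm_compCLM_le hp' _ _).trans ?_
    refine (Real.rpow_le_rpow (subordination_const_nonneg _) (A.flow_const_le t)
      (by positivity)).trans_eq ?_
    rw [Real.mul_rpow (by positivity) (by positivity), ← Real.exp_mul, mul_comm |t|]
  refine ContinuousLinearMap.opNorm_le_bound _ (by positivity) fun ℓ => ?_
  refine (ContinuousLinearMap.opNorm_comp_le ℓ (A.flowOp hp' t)).trans ?_
  rw [mul_comm]
  gcongr

/-- If the local resolvent of `ℓ` meets the open annulus of eigenvalues `e^{s t}`, then `ℓ`
annihilates the corresponding eigenvectors, hence all eigenvectors by the identity theorem. -/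
lemma eq_zero_of_mem_localResolvent (hp1 : 1 < p) (hp' : p ≠ ∞) {t : ℝ}
    {ℓ : StrongDual ℂ (HardySpace p)} {s₀ : ℂ} (hs₀ : |s₀.re| * p.toReal < 1)
    (h : Complex.exp (s₀ * t) ∈ localResolvent (adjointOp (A.flowOp hp' t)) ℓ) : ℓ = 0 := by
  have := HardySpace.completeSpace (p := p) hp'
  obtain ⟨U, ⟨hUo, g, -, hg⟩, hU⟩ := Set.mem_sUnion.1 h
  have hq : 0 < p.toReal := ENNReal.toReal_pos (by positivity) hp'
  set S : Set ℂ := Complex.re ⁻¹' Set.Ioo (-(1 / p.toReal)) (1 / p.toReal) with hS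
  have hmem {s : ℂ} : s ∈ S ↔ |s.re| * p.toReal < 1 := by
    rw [← lt_div_iff₀ hq, abs_lt]; rfl
  have hSo : IsOpen S := isOpen_Ioo.preimage Complex.continuous_re
  have hSc : Convex ℝ S := (convex_Ioo _ _).linear_preimage Complex.reLm
  have hd : DifferentiableOn ℂ (fun s => ℓ (A.powHardy p s)) S := fun s hs =>
    (ℓ.differentiableAt.comp s
      (A.differentiableAt_powHardy hp' (hmem.1 hs))).differentiableWithinAt
  have hev : ∀ᶠ s in 𝓝 s₀, ℓ (A.powHardy p s) = 0 := by
    have hc : Continuous fun s : ℂ => Complex.exp (s * t) := by fun_prop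
    filter_upwards [hSo.mem_nhds (hmem.2 hs₀), (hUo.preimage hc).mem_nhds hU] with s hs hsU
    have h1 := congrArg (fun k : StrongDual ℂ (HardySpace p) => k (A.powHardy p s)) (hg _ hsU)
    simp only [_root_.sub_apply, _root_.smul_apply] at h1
    rw [adjointOp_flowOp_apply, A.flowOp_powHardy hp' t (hmem.1 hs), map_smul, sub_self] at h1
    exact h1.symm
  have hzero := (hd.analyticOnNhd hSo).eqOn_zero_of_preconnected_of_eventuallyEq_zero
    hSc.isPreconnected (hmem.2 hs₀) hev
  exact A.eq_zero_of_apply_powHardy hp1 hp' fun s hs => hzero (hmem.2 hs)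

/-- Every local spectral subspace of the adjoint is trivial or the whole space. -/
lemma hasDunfordC_adjointOp_flowOp (hp1 : 1 < p) (hp' : p ≠ ∞) {t : ℝ} (ht : t ≠ 0) :
    HasDunfordC (adjointOp (A.flowOp (p := p) hp' t)) := by
  intro F hF
  have hq : 0 < p.toReal := ENNReal.toReal_pos (by positivity) hp'
  by_cases h : ∀ z : ℂ, z ≠ 0 → |Real.log ‖z‖| ≤ 1 / p.toReal * |t| → z ∈ F
  · have : localSpectralSubspace (adjointOp (A.flowOp (p := p) hp' t)) F = Set.univ := by
      refine Set.eq_univ_of_forall fun ℓ z hz => ?_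
      obtain ⟨h0, h1⟩ := mem_annulus_of_mem_spectrum
        (S := fun t => adjointOp (A.flowOp (p := p) hp' t))
        (fun ℓ => ContinuousLinearMap.ext fun f => by
          rw [adjointOp_flowOp_apply, flowOp_zero])
        (fun s t ℓ => ContinuousLinearMap.ext fun f => by
          rw [adjointOp_flowOp_apply, adjointOp_flowOp_apply, adjointOp_flowOp_apply,
            flowOp_flowOp])
        (A.norm_adjointOp_flowOp_le hp') (localSpectrum_subset_spectrum _ _ hz)
      exact h z h0 h1
    rw [this]
    exact isClosed_univ
  · push Not at h
    obtain ⟨a, ha0, ha, haF⟩ := h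
    -- `a` lies in the closed annulus; the points `a ^ r`, `r < 1`, lie in the open annulus
    have hc : Tendsto (fun r : ℝ => Complex.exp (r * Complex.log a)) (𝓝[<] 1) (𝓝 a) := by
      have : Continuous fun r : ℝ => Complex.exp (r * Complex.log a) := by fun_prop
      have h1 := (this.tendsto 1).mono_left (nhdsWithin_le_nhds (s := Set.Iio 1))
      rwa [Complex.ofReal_one, one_mul, Complex.exp_log ha0] at h1
    obtain ⟨r, hrF, hr0, hr1⟩ :=
      ((hc.eventually (hF.isOpen_compl.mem_nhds haF)).and eventually_radius).exists
    refine Set.Subsingleton.isClosed (Set.subsingleton_of_subset_singleton (a := 0) fun ℓ hℓ => ?_)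
    have htc : (t : ℂ) ≠ 0 := Complex.ofReal_ne_zero.2 ht
    refine A.eq_zero_of_mem_localResolvent hp1 hp' (t := t) (s₀ := r * Complex.log a / t) ?_ ?_
    · rw [Complex.div_ofReal_re, Complex.re_ofReal_mul, Complex.log_re, abs_div, abs_mul,
        abs_of_pos hr0, ← lt_div_iff₀ hq, div_lt_iff₀ (abs_pos.2 ht)]
      have : 0 < 1 / p.toReal * |t| := by have := abs_pos.2 ht; positivity
      nlinarith
    · rw [div_mul_cancel₀ _ htc]
      by_contra hcon
      exact hrF (hℓ hcon)

end Axis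

/-! ### Hyperbolic automorphisms in the half-plane coordinate -/

lemma smul_coe_eq_coe {g : GL (Fin 2) ℂ} {z w : ℂ}
    (h : g • (z : OnePoint ℂ) = (w : OnePoint ℂ)) :
    g 1 0 * z + g 1 1 ≠ 0 ∧ w * (g 1 0 * z + g 1 1) = g 0 0 * z + g 0 1 := by
  rw [OnePoint.smul_some_eq_ite] at h
  split_ifs at h with h0
  · exact absurd h (OnePoint.infty_ne_coe w)
  · refine ⟨h0, ?_⟩
    rw [← OnePoint.coe_injective h, div_mul_cancel₀ _ h0]

/-- A multiplication that preserves the right half-plane is by a positive number. -/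
lemma exists_exp_eq_of_re_pos {κ : ℂ} (h : ∀ x : ℂ, 0 < x.re → 0 < (κ * x).re) :
    ∃ t : ℝ, (Real.exp t : ℂ) = κ := by
  have hre : 0 < κ.re := by simpa using h 1 (by simp)
  have him : κ.im = 0 := by
    by_contra him
    have := h ⟨1, (κ.re + 1) / κ.im⟩ one_pos
    rw [Complex.mul_re, mul_one, mul_div_cancel₀ _ him] at this
    linarith
  refine ⟨Real.log κ.re, ?_⟩
  rw [Real.exp_log hre]
  exact Complex.ext rfl him.symm

/-- Every hyperbolic automorphism of the disc is a member of a hyperbolic flow at some time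
`t ≠ 0`. -/
lemma IsHyperbolicAutomorphism.exists_eq_flow {φ : 𝔻 → 𝔻} (hφ : IsHyperbolicAutomorphism φ) :
    ∃ (A : Axis) (t : ℝ), t ≠ 0 ∧ φ = A.flow t := by
  obtain ⟨-, g, hg, α, β, hne, hα, hβ, hfix⟩ := hφ
  obtain ⟨A, rfl, rfl⟩ := exists_axis hα hβ hne
  have hgα : g • (A.α : OnePoint ℂ) = A.α := by
    have : (A.α : OnePoint ℂ) ∈ {w : OnePoint ℂ | g • w = w} := by rw [hfix]; simp
    exact this
  have hgβ : g • (A.β : OnePoint ℂ) = A.β := by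
    have : (A.β : OnePoint ℂ) ∈ {w : OnePoint ℂ | g • w = w} := by rw [hfix]; simp
    exact this
  obtain ⟨-, hα2⟩ := smul_coe_eq_coe hgα
  obtain ⟨-, hβ2⟩ := smul_coe_eq_coe hgβ
  -- cross-multiplied forms of `α - φ z` and `φ z - β`
  have hnum (z : 𝔻) : (A.α - φ z) * (g 1 0 * z + g 1 1) =
      (A.α - z) * (g 0 0 - A.α * g 1 0) := by
    linear_combination hα2 - (smul_coe_eq_coe (hg z)).2
  have hden (z : 𝔻) : ((φ z : ℂ) - A.β) * (g 1 0 * z + g 1 1) =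
      (z - A.β) * (g 0 0 - A.β * g 1 0) := by
    linear_combination (smul_coe_eq_coe (hg z)).2 - hβ2
  have hmul (z : 𝔻) : g 0 0 - A.β * g 1 0 ≠ 0 := by
    intro h
    have := hden z
    rw [h, mul_zero] at this
    exact mul_ne_zero (A.sub_β_ne_zero (φ z).norm_lt_one) (smul_coe_eq_coe (hg z)).1 this
  set κ : ℂ := (g 0 0 - A.α * g 1 0) / (g 0 0 - A.β * g 1 0) with hκ
  have hcoord (z : 𝔻) : A.coord (φ z) = κ * A.coord z := by
    have h0 := (smul_coe_eq_coe (hg z)).1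
    have h1 := A.sub_β_ne_zero (φ z).norm_lt_one
    have h2 := A.sub_β_ne_zero z.norm_lt_one
    have h3 := hmul z
    rw [Axis.coord, Axis.coord, hκ, div_mul_div_comm, div_eq_div_iff h1 (mul_ne_zero h3 h2)]
    refine mul_right_cancel₀ h0 ?_
    linear_combination A.c * (g 0 0 - A.β * g 1 0) * (z - A.β) * hnum z -
      (g 0 0 - A.α * g 1 0) * (A.c * (A.α - z)) * hden z
  obtain ⟨t, ht⟩ := exists_exp_eq_of_re_pos (κ := κ) fun x hx => by
    have h := A.coord_re_pos (φ (Complex.UnitDisc.mk _ (A.norm_point_lt hx))).norm_lt_one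
    rwa [hcoord, Complex.UnitDisc.coe_mk, A.coord_point hx] at h
  have hflow : φ = A.flow t :=
    funext fun z => A.coord_injective (by rw [hcoord, A.coord_flow, ht])
  refine ⟨A, t, ?_, hflow⟩
  -- the identity would have the fixed point `0`
  rintro rfl
  have h0 : ((0 : ℂ) : OnePoint ℂ) ∈ {w : OnePoint ℂ | g • w = w} := by
    have := hg 0
    rw [hflow, A.flow_zero] at this
    simpa using this
  rw [hfix] at h0
  rcases h0 with h0 | h0
  · have := OnePoint.coe_injective h0
    rw [← this] at hα; simp at hα
  · have := OnePoint.coe_injective (Set.mem_singleton_iff.1 h0)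
    rw [← this] at hβ; simp at hβ

end DunfordC

end

theorem mainTheorem2 (φ : 𝔻 → 𝔻) (hφ : DunfordC.IsHyperbolicAutomorphism φ) :
    (∀ (p : ℝ≥0∞) [Fact (1 ≤ p)], p ≠ ∞ →
      ∃ C : DunfordC.HardySpace p →L[ℂ] DunfordC.HardySpace p,
        DunfordC.IsCompositionOperator φ C ∧ ¬ DunfordC.HasSVEP C) ∧
    (∀ (p : ℝ≥0∞) [Fact (1 ≤ p)], 1 < p → p ≠ ∞ →
      ∃ C : DunfordC.HardySpace p →L[ℂ] DunfordC.HardySpace p,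
        DunfordC.IsCompositionOperator φ C ∧ DunfordC.HasDunfordC (DunfordC.adjointOp C)) := by
  obtain ⟨A, t, ht, rfl⟩ := hφ.exists_eq_flow
  exact ⟨fun p _ hp' => ⟨A.flowOp hp' t, fun _ _ => rfl, A.not_hasSVEP_flowOp hp' ht⟩,
    fun p _ hp1 hp' => ⟨A.flowOp hp' t, fun _ _ => rfl,
      A.hasDunfordC_adjointOp_flowOp hp1 hp' ht⟩⟩
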